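/- **Model.** Fix $\beta>0$ and a budget $b\ge 0$. The type space is $V=\{(v_1,v_2)\in[0,\beta]^2: v_1\ge v_2\}$ ($v_1$ is the value of the agent, $v_2$ that of the principal), and types have a joint probability density $f$ on $V$. An outcome is a pair $(a,t)$ of an allocation probability $a\in[0,1]$ and a payment $t\in\mathbb R$. For a set $X$ of outcomes let $X_b=\{(a,t)\in X: t\le b\}$, and for a value $w$ let $Ch(X;w)$ be the set of $(a,t)\in X$ that maximize $wa-t$ over $X$. Write $X\rhd_w Y$ if $wa-t\ge wa'-t'$ for all $(a,t)\in X$, $(a',t')\in Y$, with strict inequality for at least one such pair. A pair of type $v=(v_1,v_2)$ chooses from $X$ according to $Ch(X;v)=Ch(X;v_2)$ if $Ch(X;v_2)\rhd_{v_1}Ch(X_b;v_1)$, and $Ch(X;v)=Ch(X_b;v_1)$ otherwise. A mechanism is a pair $(q,p)$ with $q:V\to[0,1]$, $p:V\to\mathbb R$; its range is $R=\{(q(v),p(v)):v\in V\}$. It is incentive compatible (IC) if $(q(v),p(v))\in Ch(R;v)$ for all $v\in V$, and individually rational (IR) if $(0,0)\in R$. Its expected revenue is $\int_V p(v)f(v)\,dv$.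 A mechanism is *optimal* if it is IC and IR and has the highest expected revenue among all IC and IR mechanisms (with integrable payments). The POST-1 mechanism with price $\kappa\in[0,b]$ is $(0,0)$ if $v_1\le\kappa$ and $(1,\kappa)$ otherwise. For $b\le\kappa\le\beta$, $\kappa>0$, the uniform POST-2 mechanism with price $\kappa$ is $(0,0)$ if $v_1<\kappa$; $\big(1,\,b+\kappa(1-\tfrac b\kappa)\big)=(1,\kappa)$ if $v_2>\kappa$; and $(\tfrac b\kappa,b)$ otherwise. Let $F_i$ be the cdf of $v_i$ and $f_i$ a density of it on $[0,\beta]$ that is positive and differentiable on $(0,\beta)$, $i=1,2$. Let $\tilde\kappa_i$ be a maximizer of $x(1-F_i(x))$ over $[0,\beta]$. **Theorem.** Assume that $f_1/f_2$ is (weakly) increasing on $(0,\beta)$ (MLRP), that $x(1-F_1(x))$ is strictly concave on $[0,\beta]$, that $x-\frac{1-F_2(x)}{f_2(x)}$ crosses zero exactly once on $(0,\beta)$, from negative to positive (single crossing), and that $b<\tilde\kappa_1$. 1. If $b<\tilde\kappa_2$ and $\frac{f_1(\tilde\kappa_2)}{f_2(\tilde\kappa_2)}\le 1$, then there is $\kappa^*\in(b,\beta)$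 with $\kappa^* f_2(\kappa^*)-(1-F_2(\kappa^*))=b\,(f_2(\kappa^*)-f_1(\kappa^*))$ such that the uniform POST-2 mechanism with price $\kappa^*$ is optimal. 2. If $\tilde\kappa_2\le b$ and $\frac{f_1(\tilde\kappa_2)}{f_2(\tilde\kappa_2)}>1$, then the uniform POST-2 mechanism with price $b$ is optimal, and so is the POST-1 mechanism with price $b$. 3. If $\tilde\kappa_2\le b$ and $\frac{f_1(\tilde\kappa_2)}{f_2(\tilde\kappa_2)}\le 1<\frac{f_1(b)}{f_2(b)}$, then the uniform POST-2 mechanism with price $b$ is optimal, and so is the POST-1 mechanism with price $b$. -/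

import Mathlib

open Set MeasureTheory

noncomputable section

namespace PrincipalAgent

/-- The type space `V = {(v₁, v₂) ∈ [0, β]² : v₁ ≥ v₂}`; `v.1` is the value of the agent and
`v.2` is the value of the principal. -/
def typeSpace (β : ℝ) : Set (ℝ × ℝ) :=
  {v | v.1 ∈ Icc 0 β ∧ v.2 ∈ Icc 0 β ∧ v.2 ≤ v.1}

/-- The payoff `w a - t` of the outcome `(a, t)` (allocation probability `a`, payment `t`) at the
value `w`. -/
def payoff (w : ℝ) (z : ℝ × ℝ) : ℝ := w * z.1 - z.2

/-- The budget set `X_b` of the agent. -/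
def budgetSet (b : ℝ) (X : Set (ℝ × ℝ)) : Set (ℝ × ℝ) := {z ∈ X | z.2 ≤ b}

/-- The individual choice correspondence `Ch(X; w)`: the payoff-maximal outcomes of `X`. -/
def choice (X : Set (ℝ × ℝ)) (w : ℝ) : Set (ℝ × ℝ) :=
  {z ∈ X | ∀ z' ∈ X, payoff w z' ≤ payoff w z}

/-- `X ⊵_w Y`. -/
def WeaklyBetter (w : ℝ) (X Y : Set (ℝ × ℝ)) : Prop :=
  ∀ z ∈ X, ∀ z' ∈ Y, payoff w z' ≤ payoff w z

/-- `X ▷_w Y`: `X ⊵_w Y`, with a strict inequality for at least one pair of outcomes. -/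
def StrictlyBetter (w : ℝ) (X Y : Set (ℝ × ℝ)) : Prop :=
  WeaklyBetter w X Y ∧ ∃ z ∈ X, ∃ z' ∈ Y, payoff w z' < payoff w z

open Classical in
/-- The choice `Ch(X; v)` of the principal-agent pair of type `v = (v₁, v₂)`: the agent hands the
decision over to the principal exactly when `Ch(X; v₂) ▷_{v₁} Ch(X_b; v₁)`. -/
def pairChoice (b : ℝ) (X : Set (ℝ × ℝ)) (v : ℝ × ℝ) : Set (ℝ × ℝ) :=
  if StrictlyBetter v.1 (choice X v.2) (choice (budgetSet b X) v.1) then choice X v.2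
  else choice (budgetSet b X) v.1

/-- The data of a direct mechanism: an allocation rule and a payment rule. Only their values on the
type space are ever used. -/
structure Mechanism where
  alloc : ℝ × ℝ → ℝ
  pay : ℝ × ℝ → ℝ

namespace Mechanism

/-- The allocation rule takes values in `[0, 1]` on the type space. -/
def IsValid (M : Mechanism) (β : ℝ) : Prop :=
  ∀ v ∈ typeSpace β, M.alloc v ∈ Icc (0 : ℝ) 1

/-- The range `R(q, p)` of the mechanism. -/
def range (M : Mechanism) (β : ℝ) : Set (ℝ × ℝ) :=
  (fun v => (M.alloc v, M.pay v)) '' typeSpace β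

/-- Incentive compatibility. -/
def IsIC (M : Mechanism) (β b : ℝ) : Prop :=
  ∀ v ∈ typeSpace β, (M.alloc v, M.pay v) ∈ pairChoice b (M.range β) v

/-- Individual rationality. -/
def IsIR (M : Mechanism) (β : ℝ) : Prop :=
  ((0 : ℝ), (0 : ℝ)) ∈ M.range β

/-- The expected revenue `∫_V p(v) f(v) dv`. -/
def revenue (M : Mechanism) (β : ℝ) (f : ℝ × ℝ → ℝ) : ℝ :=
  ∫ v in typeSpace β, M.pay v * f v

/-- The IC and IR mechanisms whose expected revenue is well defined. -/
def IsFeasible (M : Mechanism) (β b : ℝ) (f : ℝ × ℝ → ℝ) : Prop :=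
  M.IsValid β ∧ M.IsIC β b ∧ M.IsIR β ∧
    IntegrableOn (fun v => M.pay v * f v) (typeSpace β)

/-- Optimality: feasible, with the highest expected revenue among feasible mechanisms. -/
def IsOptimal (M : Mechanism) (β b : ℝ) (f : ℝ × ℝ → ℝ) : Prop :=
  M.IsFeasible β b f ∧
    ∀ M' : Mechanism, M'.IsFeasible β b f → M'.revenue β f ≤ M.revenue β f

end Mechanism

/-- The POST-1 mechanism with price `κ` (to be used with `0 ≤ κ ≤ b`). -/
def post1 (κ : ℝ) : Mechanism where
  alloc v := if v.1 ≤ κ then 0 else 1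
  pay v := if v.1 ≤ κ then 0 else κ

/-- The POST-2 mechanism with prices `κ₁, κ₂` (to be used with `b ≤ κ₁ ≤ κ₂ ≤ β`). -/
def post2 (b κ₁ κ₂ : ℝ) : Mechanism where
  alloc v := if v.1 < κ₁ then 0 else if κ₂ < v.2 then 1 else b / κ₁
  pay v := if v.1 < κ₁ then 0 else if κ₂ < v.2 then b + κ₂ * (1 - b / κ₁) else b

/-- The uniform POST-2 mechanism with price `κ` (to be used with `b ≤ κ ≤ β`). -/
def uniformPost2 (b κ : ℝ) : Mechanism := post2 b κ κ

/-- The measure on `ℝ²` with density `f`. -/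
def law (f : ℝ × ℝ → ℝ) : Measure (ℝ × ℝ) :=
  volume.withDensity fun v => ENNReal.ofReal (f v)

/-- `f` is a probability density carried by the type space. -/
structure IsPrior (β : ℝ) (f : ℝ × ℝ → ℝ) : Prop where
  measurable : Measurable f
  nonneg : ∀ v, 0 ≤ f v
  eq_zero : ∀ v, v ∉ typeSpace β → f v = 0
  isProbability : IsProbabilityMeasure (law f)

/-- The marginal law of the value of the agent. -/
def agentLaw (f : ℝ × ℝ → ℝ) : Measure ℝ := (law f).map Prod.fst

/-- The marginal law of the value of the principal. -/
def principalLaw (f : ℝ × ℝ → ℝ) : Measure ℝ := (law f).map Prod.snd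

/-- The marginal cdf `F₁` of the value of the agent. -/
def agentCDF (f : ℝ × ℝ → ℝ) (x : ℝ) : ℝ := ProbabilityTheory.cdf (agentLaw f) x

/-- The marginal cdf `F₂` of the value of the principal. -/
def principalCDF (f : ℝ × ℝ → ℝ) (x : ℝ) : ℝ := ProbabilityTheory.cdf (principalLaw f) x

/-- `g` is a density on `[0, β]` of the law `μ`, positive and differentiable inside `[0, β]`. -/
structure IsRegularDensity (β : ℝ) (μ : Measure ℝ) (g : ℝ → ℝ) : Prop where
  density : μ = (volume.restrict (Icc 0 β)).withDensity fun x => ENNReal.ofReal (g x)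
  pos : ∀ x ∈ Ioo 0 β, 0 < g x
  differentiable : DifferentiableOn ℝ g (Ioo 0 β)

/-- The monotone likelihood ratio property: `f₁ / f₂` is increasing. -/
def MLRP (β : ℝ) (f₁ f₂ : ℝ → ℝ) : Prop :=
  MonotoneOn (fun x => f₁ x / f₂ x) (Ioo 0 β)

/-- Single crossing: `x - (1 - F(x)) / g(x)` crosses zero exactly once (it is negative near `0` and
positive near `β`). -/
def SingleCrossing (β : ℝ) (F g : ℝ → ℝ) : Prop :=
  ∃ c ∈ Ioo 0 β,
    (∀ x ∈ Ioo 0 c, x - (1 - F x) / g x < 0) ∧ (∀ x ∈ Ioo c β, 0 < x - (1 - F x) / g x)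

/-- `κ` maximizes `x (1 - F(x))` over `[0, β]`. -/
def IsMonopolyPrice (β : ℝ) (F : ℝ → ℝ) (κ : ℝ) : Prop :=
  κ ∈ Icc 0 β ∧ IsMaxOn (fun x => x * (1 - F x)) (Icc 0 β) κ

end PrincipalAgent

end

noncomputable section

namespace PrincipalAgent

/-! ### Laws with a regular density -/

namespace IsRegularDensity

variable {β : ℝ} {μ : Measure ℝ} {g : ℝ → ℝ}

lemma aemeasurable (hg : IsRegularDensity β μ g) :
    AEMeasurable g (volume.restrict (Icc 0 β)) := by
  rw [← restrict_Ioo_eq_restrict_Icc]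
  exact hg.differentiable.continuousOn.aemeasurable measurableSet_Ioo

lemma ae_nonneg (hg : IsRegularDensity β μ g) :
    ∀ᵐ x ∂(volume.restrict (Icc 0 β)), 0 ≤ g x := by
  rw [← restrict_Ioo_eq_restrict_Icc]
  exact (ae_restrict_mem measurableSet_Ioo).mono fun x hx => (hg.pos x hx).le

lemma integrableOn [IsProbabilityMeasure μ] (hg : IsRegularDensity β μ g) :
    IntegrableOn g (Icc 0 β) := by
  refine ⟨hg.aemeasurable.aestronglyMeasurable, ?_⟩
  have h1 : μ univ = 1 := measure_univ
  rw [hg.density, withDensity_apply _ MeasurableSet.univ, Measure.restrict_univ] at h1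
  rw [hasFiniteIntegral_iff_ofReal hg.ae_nonneg, h1]
  exact ENNReal.one_lt_top

lemma integral_eq (hg : IsRegularDensity β μ g) (h : ℝ → ℝ) :
    ∫ x, h x ∂μ = ∫ x in Icc 0 β, h x * g x := by
  rw [hg.density, integral_withDensity_eq_integral_toReal_smul₀ hg.aemeasurable.ennreal_ofReal
    (by simp)]
  refine integral_congr_ae ?_
  filter_upwards [hg.ae_nonneg] with x hx
  rw [ENNReal.toReal_ofReal hx, smul_eq_mul, mul_comm]

lemma intervalIntegrable [IsProbabilityMeasure μ] (hg : IsRegularDensity β μ g) {x y : ℝ}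
    (hx : x ∈ Icc 0 β) (hy : y ∈ Icc 0 β) : IntervalIntegrable g volume x y :=
  ((hg.integrableOn.mono_set (uIcc_subset_Icc hx hy))).intervalIntegrable

lemma cdf_eq_integral [IsProbabilityMeasure μ] (hg : IsRegularDensity β μ g) {x : ℝ}
    (hx : x ∈ Icc 0 β) : ProbabilityTheory.cdf μ x = ∫ y in (0 : ℝ)..x, g y := by
  have h := hg.integral_eq ((Iic x).indicator 1)
  rw [integral_indicator_one measurableSet_Iic] at h
  rw [ProbabilityTheory.cdf_eq_real, h, intervalIntegral.integral_of_le hx.1,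
    ← integral_Icc_eq_integral_Ioc]
  have : ∀ y, (Iic x).indicator (1 : ℝ → ℝ) y * g y = (Iic x).indicator g y := by
    intro y; by_cases hy : y ∈ Iic x <;> simp [hy]
  simp_rw [this]
  rw [setIntegral_indicator measurableSet_Iic]
  congr 2
  ext y
  simp only [mem_inter_iff, mem_Icc, mem_Iic]
  constructor
  · rintro ⟨h1, h2⟩; exact ⟨h1.1, h2⟩
  · rintro ⟨h1, h2⟩; exact ⟨⟨h1, h2.trans hx.2⟩, h2⟩

lemma continuousOn_cdf [IsProbabilityMeasure μ] (hg : IsRegularDensity β μ g) :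
    ContinuousOn (ProbabilityTheory.cdf μ) (Icc 0 β) := by
  rcases lt_or_ge β 0 with hβ | hβ
  · simp [Icc_eq_empty hβ.not_ge]
  refine ContinuousOn.congr ?_ fun x hx => hg.cdf_eq_integral hx
  have := intervalIntegral.continuousOn_primitive_interval (f := g) (a := 0) (b := β)
    (μ := volume) (by rw [uIcc_of_le hβ]; exact hg.integrableOn)
  rwa [uIcc_of_le hβ] at this

lemma hasDerivAt_cdf [IsProbabilityMeasure μ] (hg : IsRegularDensity β μ g) {x : ℝ}
    (hx : x ∈ Ioo 0 β) : HasDerivAt (ProbabilityTheory.cdf μ) (g x) x := by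
  have h0 : (0 : ℝ) ∈ Icc 0 β := ⟨le_rfl, (hx.1.trans hx.2).le⟩
  have hd := intervalIntegral.integral_hasDerivAt_right
    (hg.intervalIntegrable h0 (Ioo_subset_Icc_self hx))
    (hg.differentiable.continuousOn.stronglyMeasurableAtFilter isOpen_Ioo x hx)
    ((hg.differentiable.continuousOn.continuousAt (isOpen_Ioo.mem_nhds hx)))
  refine hd.congr_of_eventuallyEq ?_
  filter_upwards [isOpen_Ioo.mem_nhds hx] with y hy
  exact hg.cdf_eq_integral (Ioo_subset_Icc_self hy)

lemma cdf_zero [IsProbabilityMeasure μ] (hg : IsRegularDensity β μ g) (hβ : 0 ≤ β) :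
    ProbabilityTheory.cdf μ 0 = 0 := by
  rw [hg.cdf_eq_integral ⟨le_rfl, hβ⟩, intervalIntegral.integral_same]

lemma cdf_right [IsProbabilityMeasure μ] (hg : IsRegularDensity β μ g) (hβ : 0 ≤ β) :
    ProbabilityTheory.cdf μ β = 1 := by
  have h := hg.integral_eq (fun _ => 1)
  rw [integral_const, probReal_univ] at h
  rw [hg.cdf_eq_integral ⟨hβ, le_rfl⟩, intervalIntegral.integral_of_le hβ,
    ← integral_Icc_eq_integral_Ioc]
  simpa using h.symm

end IsRegularDensity

/-! ### Right slopes of convex functions -/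

/-- The right derivative of `U` at `x`. -/
def rightSlope (U : ℝ → ℝ) (x : ℝ) : ℝ := derivWithin U (Ioi x) x

/-- The payment `x U'₊(x) - U(x)` of the rightmost outcome chosen at `x` when the indirect utility
is `U`. -/
def rightPay (U : ℝ → ℝ) (x : ℝ) : ℝ := x * rightSlope U x - U x

/-- An indirect utility: convex, increasing and with slopes at most one. -/
structure IsIndirectUtility (U : ℝ → ℝ) : Prop where
  convex : ConvexOn ℝ univ U
  mono : Monotone U
  slope_le : ∀ ⦃x y⦄, x ≤ y → U y - U x ≤ y - x

namespace IsIndirectUtility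

variable {U : ℝ → ℝ}

lemma continuous (hU : IsIndirectUtility U) : Continuous U := by
  have := hU.convex.continuousOn_interior
  rwa [interior_univ, ← continuousOn_univ.symm] at this

lemma hasDerivWithinAt (hU : IsIndirectUtility U) (x : ℝ) :
    HasDerivWithinAt U (rightSlope U x) (Ioi x) x :=
  hU.convex.hasDerivWithinAt_rightDeriv_of_mem_interior (by simp)

lemma monotone_rightSlope (hU : IsIndirectUtility U) : Monotone (rightSlope U) := by
  have := hU.convex.monotoneOn_rightDeriv
  rw [interior_univ, monotoneOn_univ] at this
  exact this

lemma measurable_rightPay (hU : IsIndirectUtility U) : Measurable (rightPay U) :=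
  (measurable_id.mul hU.monotone_rightSlope.measurable).sub hU.continuous.measurable

lemma rightSlope_mul_le (hU : IsIndirectUtility U) (x y : ℝ) :
    U x + rightSlope U x * (y - x) ≤ U y := by
  rcases lt_trichotomy x y with h | rfl | h
  · have := hU.convex.rightDeriv_le_slope_of_mem_interior (x := x) (y := y) (by simp) (by simp) h
    rw [slope_def_field, le_div_iff₀ (by linarith)] at this
    unfold rightSlope; linarith
  · simp
  · have h1 := hU.convex.slope_le_leftDeriv_of_mem_interior (x := y) (y := x) (by simp) (by simp) h
    have h2 := hU.convex.leftDeriv_le_rightDeriv_of_mem_interior (x := x) (by simp)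
    have := h1.trans h2
    rw [slope_def_field, div_le_iff₀ (by linarith)] at this
    unfold rightSlope; linarith

lemma le_rightSlope (hU : IsIndirectUtility U) {x q : ℝ} (h : ∀ y, x < y → U x + q * (y - x) ≤ U y) :
    q ≤ rightSlope U x := by
  have hd := (hU.hasDerivWithinAt x)
  rw [hasDerivWithinAt_iff_tendsto_slope' (by simp)] at hd
  refine ge_of_tendsto hd ?_
  filter_upwards [self_mem_nhdsWithin] with y hy
  have hy : x < y := hy
  rw [slope_def_field, le_div_iff₀ (by linarith)]
  linarith [h y hy]

lemma rightSlope_nonneg (hU : IsIndirectUtility U) (x : ℝ) : 0 ≤ rightSlope U x :=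
  hU.le_rightSlope fun y hy => by linarith [hU.mono hy.le]

lemma rightSlope_le_one (hU : IsIndirectUtility U) (x : ℝ) : rightSlope U x ≤ 1 := by
  have h1 := hU.rightSlope_mul_le x (x + 1)
  have h2 := hU.slope_le (show x ≤ x + 1 by linarith)
  linarith

lemma le_rightPay (hU : IsIndirectUtility U) {x q t : ℝ} (hx : 0 ≤ x) (ht : U x = x * q - t)
    (h : ∀ y, y * q - t ≤ U y) : t ≤ rightPay U x := by
  have := hU.le_rightSlope (x := x) (q := q) fun y _ => by linarith [h y]
  unfold rightPay
  nlinarith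

lemma abs_rightPay_le (hU : IsIndirectUtility U) {x β : ℝ} (hx : x ∈ Icc 0 β) :
    |rightPay U x| ≤ β + (|U 0| + |U β|) := by
  have h1 := hU.rightSlope_nonneg x
  have h2 := hU.rightSlope_le_one x
  have h3 := hU.mono hx.1
  have h4 := hU.mono hx.2
  have := neg_abs_le (U 0)
  have := le_abs_self (U β)
  have := abs_nonneg (U 0)
  have := abs_nonneg (U β)
  obtain ⟨h5, h6⟩ := hx
  unfold rightPay
  rw [abs_le]
  constructor <;> nlinarith

end IsIndirectUtility

/-- Integration by parts for the payments of an indirect utility. -/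
lemma integral_rightPay_mul {U H φ : ℝ → ℝ} (hU : IsIndirectUtility U) {a c : ℝ} (hac : a ≤ c)
    (hH : ContinuousOn H (Icc a c)) (hd : ∀ x ∈ Ioo a c, HasDerivAt H (φ x) x)
    (hφ : IntervalIntegrable φ volume a c) :
    IntervalIntegrable (fun x => rightPay U x * φ x) volume a c ∧
    IntervalIntegrable (fun x => rightSlope U x * (x * φ x + H x)) volume a c ∧
    ∫ x in a..c, rightPay U x * φ x =
      (∫ x in a..c, rightSlope U x * (x * φ x + H x)) - (U c * H c - U a * H a) := by
  have hUc : ContinuousOn U (uIcc a c) := hU.continuous.continuousOn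
  have hHc : ContinuousOn H (uIcc a c) := by rwa [uIcc_of_le hac]
  have hs : ∀ {ψ : ℝ → ℝ}, IntervalIntegrable ψ volume a c →
      IntervalIntegrable (fun x => rightSlope U x * ψ x) volume a c := by
    intro ψ hψ
    rw [intervalIntegrable_iff] at hψ ⊢
    refine Integrable.bdd_mul (c := 1) hψ hU.monotone_rightSlope.measurable.aestronglyMeasurable ?_
    refine Filter.Eventually.of_forall fun x => ?_
    rw [Real.norm_eq_abs, abs_of_nonneg (hU.rightSlope_nonneg x)]
    exact hU.rightSlope_le_one x
  have i1 := hs ((hφ.continuousOn_mul continuousOn_id).add hHc.intervalIntegrable)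
  have i2 := (hs hHc.intervalIntegrable).add (hφ.continuousOn_mul hUc)
  have key : ∫ x in a..c, (rightSlope U x * H x + U x * φ x) = U c * H c - U a * H a := by
    refine intervalIntegral.integral_eq_sub_of_hasDeriv_right (f := fun x => U x * H x)
      (hUc.mul hHc) (fun x hx => ?_) i2
    rw [min_eq_left hac, max_eq_right hac] at hx
    exact (hU.hasDerivWithinAt x).mul (hd x hx).hasDerivWithinAt
  have e : (fun x => rightPay U x * φ x) = fun x => rightSlope U x * (x * φ x + H x) -
      (rightSlope U x * H x + U x * φ x) := by
    ext x; unfold rightPay; ring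
  refine ⟨?_, i1, ?_⟩
  · rw [e]; exact i1.sub i2
  · rw [e, ← key]; exact intervalIntegral.integral_sub i1 i2

/-! ### Revenue bounds for the two values -/

section revenueBounds

variable {β : ℝ} {μ : Measure ℝ} [IsProbabilityMeasure μ] {g : ℝ → ℝ}

open ProbabilityTheory (cdf)

lemma IsRegularDensity.hasDerivAt_mul_cdf (hg : IsRegularDensity β μ g) {x : ℝ}
    (hx : x ∈ Ioo 0 β) : HasDerivAt (fun x => x * cdf μ x) (x * g x + cdf μ x) x := by
  have := (hasDerivAt_id x).mul (hg.hasDerivAt_cdf hx)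
  simp only [id, one_mul] at this
  rw [add_comm]
  exact this

lemma IsRegularDensity.hasDerivAt_monopolyRevenue (hg : IsRegularDensity β μ g) {x : ℝ}
    (hx : x ∈ Ioo 0 β) :
    HasDerivAt (fun x => x * (1 - cdf μ x)) (1 - (x * g x + cdf μ x)) x := by
  have := (hasDerivAt_id x).sub (hg.hasDerivAt_mul_cdf hx)
  refine this.congr_of_eventuallyEq (Filter.Eventually.of_forall fun y => ?_)
  simp only [id, Pi.sub_apply]; ring

lemma IsRegularDensity.integral_mul_add_cdf (hg : IsRegularDensity β μ g) {a c : ℝ}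
    (ha : 0 ≤ a) (hac : a ≤ c) (hc : c ≤ β) :
    IntervalIntegrable (fun x => x * g x + cdf μ x) volume a c ∧
    ∫ x in a..c, (x * g x + cdf μ x) = c * cdf μ c - a * cdf μ a := by
  have hF : ContinuousOn (cdf μ) (uIcc a c) := by
    rw [uIcc_of_le hac]; exact hg.continuousOn_cdf.mono (Icc_subset_Icc ha hc)
  have hgi := hg.intervalIntegrable (x := a) (y := c) ⟨ha, hac.trans hc⟩ ⟨ha.trans hac, hc⟩
  have hi := (hgi.continuousOn_mul continuousOn_id).add hF.intervalIntegrable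
  refine ⟨hi, ?_⟩
  refine intervalIntegral.integral_eq_sub_of_hasDeriv_right (f := fun x => x * cdf μ x)
    (continuousOn_id.mul hF) (fun x hx => ?_) hi
  rw [min_eq_left hac, max_eq_right hac] at hx
  exact (hg.hasDerivAt_mul_cdf ⟨ha.trans_lt hx.1, hx.2.trans_le hc⟩).hasDerivWithinAt

lemma IsRegularDensity.monotoneOn_mul_add_cdf (hg : IsRegularDensity β μ g)
    (hconc : ConcaveOn ℝ (Icc 0 β) fun x => x * (1 - cdf μ x)) :
    MonotoneOn (fun x => x * g x + cdf μ x) (Ioo 0 β) := by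
  have h := (hconc.subset Ioo_subset_Icc_self (convex_Ioo 0 β)).antitoneOn_deriv
    fun x hx => (hg.hasDerivAt_monopolyRevenue hx).differentiableAt
  intro x hx y hy hxy
  have := h hx hy hxy
  rw [(hg.hasDerivAt_monopolyRevenue hx).deriv, (hg.hasDerivAt_monopolyRevenue hy).deriv] at this
  linarith

/-- When monopoly revenue is concave, the payments below `k` of an indirect utility with slopes at
most `α` raise at most the revenue of offering allocation `α` at unit price `y`. -/
lemma integral_rightPay_le_of_concaveOn (hg : IsRegularDensity β μ g)
    (hconc : ConcaveOn ℝ (Icc 0 β) fun x => x * (1 - cdf μ x))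
    {U : ℝ → ℝ} (hU : IsIndirectUtility U) (hU0 : 0 ≤ U 0) {k y α : ℝ} (hy : 0 ≤ y) (hyk : y ≤ k)
    (hkβ : k ≤ β) (hUk : U k = α * (k - y))
    (hs : ∀ x, 0 ≤ x → x < k → rightSlope U x ≤ α) :
    ∫ x in (0 : ℝ)..k, rightPay U x * g x ≤ α * y * (cdf μ k - cdf μ y) := by
  have hk : 0 ≤ k := hy.trans hyk
  have hβ : 0 ≤ β := hk.trans hkβ
  obtain ⟨-, i1, e1⟩ := integral_rightPay_mul hU hk
    (hg.continuousOn_cdf.mono (Icc_subset_Icc le_rfl hkβ))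
    (fun x hx => hg.hasDerivAt_cdf ⟨hx.1, hx.2.trans_le hkβ⟩)
    (hg.intervalIntegrable ⟨le_rfl, hβ⟩ ⟨hk, hkβ⟩)
  rw [e1, hg.cdf_zero hβ]
  have hP : ∀ x ∈ Ioo 0 k, 0 ≤ x * g x + cdf μ x := fun x hx =>
    add_nonneg (mul_nonneg hx.1.le (hg.pos x ⟨hx.1, hx.2.trans_le hkβ⟩).le)
      (ProbabilityTheory.cdf_nonneg _ _)
  suffices h : ∫ x in (0 : ℝ)..k, rightSlope U x * (x * g x + cdf μ x) ≤
      α * (k * cdf μ k - y * cdf μ y) by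
    rw [hUk]; linarith
  rcases hy.eq_or_lt with rfl | hy0
  · obtain ⟨i2, e2⟩ := hg.integral_mul_add_cdf le_rfl hk hkβ
    rw [← e2, ← intervalIntegral.integral_const_mul]
    exact intervalIntegral.integral_mono_on_of_le_Ioo hk i1 (i2.const_mul α) fun x hx =>
      mul_le_mul_of_nonneg_right (hs x hx.1.le hx.2) (hP x hx)
  rcases hyk.eq_or_lt with rfl | hyk'
  · have : ∫ x in (0 : ℝ)..y, rightSlope U x * (x * g x + cdf μ x) ≤ ∫ _ in (0 : ℝ)..y, (0 : ℝ) := by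
      refine intervalIntegral.integral_mono_on_of_le_Ioo hk i1 (by simp) fun x hx => ?_
      have h1 := hU.rightSlope_mul_le x y
      have h2 := hU.mono hx.1.le
      have h3 : rightSlope U x ≤ 0 := by
        by_contra! h
        nlinarith [mul_pos h (sub_pos.2 hx.2)]
      exact mul_nonpos_of_nonpos_of_nonneg h3 (hP x hx)
    simpa using this
  have hmono := hg.monotoneOn_mul_add_cdf hconc
  have hyI : y ∈ Ioo 0 β := ⟨hy0, hyk'.trans_le hkβ⟩
  set c := y * g y + cdf μ y with hc
  have hc0 : 0 ≤ c := hP y ⟨hy0, hyk'⟩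
  have is : ∀ a d, IntervalIntegrable (rightSlope U) volume a d := fun a d =>
    hU.monotone_rightSlope.intervalIntegrable
  have es : ∫ x in (0 : ℝ)..k, rightSlope U x = U k - U 0 :=
    intervalIntegral.integral_eq_sub_of_hasDeriv_right hU.continuous.continuousOn
      (fun x _ => hU.hasDerivWithinAt x) (is _ _)
  obtain ⟨i3, e3⟩ := hg.integral_mul_add_cdf hy hyk hkβ
  have i10 : IntervalIntegrable (fun x => rightSlope U x * (x * g x + cdf μ x)) volume 0 y :=
    i1.mono_set (by rw [uIcc_of_le hy, uIcc_of_le hk]; exact Icc_subset_Icc le_rfl hyk)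
  have i11 : IntervalIntegrable (fun x => rightSlope U x * (x * g x + cdf μ x)) volume y k :=
    i1.mono_set (by rw [uIcc_of_le hyk, uIcc_of_le hk]; exact Icc_subset_Icc hy le_rfl)
  have b1 : ∫ x in (0 : ℝ)..y, rightSlope U x * (x * g x + cdf μ x) ≤
      c * ∫ x in (0 : ℝ)..y, rightSlope U x := by
    rw [← intervalIntegral.integral_const_mul]
    refine intervalIntegral.integral_mono_on_of_le_Ioo hy i10 ((is _ _).const_mul c) fun x hx => ?_
    rw [mul_comm c]
    exact mul_le_mul_of_nonneg_left (hmono ⟨hx.1, hx.2.trans hyI.2⟩ hyI hx.2.le)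
      (hU.rightSlope_nonneg x)
  have b2 : ∫ x in y..k, rightSlope U x * (x * g x + cdf μ x) ≤
      α * (∫ x in y..k, (x * g x + cdf μ x)) + c * ((∫ x in y..k, rightSlope U x) -
        ∫ _ in y..k, α) := by
    rw [← intervalIntegral.integral_sub (is _ _) (by simp), ← intervalIntegral.integral_const_mul,
      ← intervalIntegral.integral_const_mul,
      ← intervalIntegral.integral_add (i3.const_mul α) (((is _ _).sub (by simp)).const_mul c)]
    refine intervalIntegral.integral_mono_on_of_le_Ioo hyk i11
      ((i3.const_mul α).add (((is _ _).sub (by simp)).const_mul c)) fun x hx => ?_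
    have h1 := hs x (hy.trans hx.1.le) hx.2
    have h2 := hmono hyI ⟨hy0.trans hx.1, hx.2.trans_le hkβ⟩ hx.1.le
    simp only at h2
    nlinarith [mul_nonneg (sub_nonneg.2 h1) (sub_nonneg.2 h2)]
  rw [e3, intervalIntegral.integral_const, smul_eq_mul] at b2
  rw [← intervalIntegral.integral_add_adjacent_intervals i10 i11]
  rw [← intervalIntegral.integral_add_adjacent_intervals (is 0 y) (is y k), hUk] at es
  have := mul_nonneg hc0 hU0
  have : c * (∫ x in (0 : ℝ)..y, rightSlope U x) + c * (∫ x in y..k, rightSlope U x) =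
      c * (α * (k - y) - U 0) := by rw [← es]; ring
  linarith

/-- The sign pattern of marginal revenue given by single crossing at `c`. -/
structure CrossesAt (β : ℝ) (F g : ℝ → ℝ) (c : ℝ) : Prop where
  mem : c ∈ Ioo 0 β
  neg : ∀ x ∈ Ioo 0 c, x * g x + F x - 1 < 0
  pos : ∀ x ∈ Ioo c β, 0 < x * g x + F x - 1

lemma SingleCrossing.exists_crossesAt {F : ℝ → ℝ} (h : SingleCrossing β F g)
    (hg : ∀ x ∈ Ioo 0 β, 0 < g x) : ∃ c, CrossesAt β F g c := by
  obtain ⟨c, hc, h1, h2⟩ := h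
  refine ⟨c, hc, fun x hx => ?_, fun x hx => ?_⟩
  · have := h1 x hx
    have hgx := hg x ⟨hx.1, hx.2.trans hc.2⟩
    rw [sub_lt_zero, lt_div_iff₀ hgx] at this
    linarith
  · have := h2 x hx
    have hgx := hg x ⟨hc.1.trans hx.1, hx.2⟩
    rw [sub_pos, div_lt_iff₀ hgx] at this
    linarith

/-- Under single crossing, the payments above `k` of an indirect utility with slopes at least `α`
raise at most the revenue of selling the additional allocation `1 - α` at the best price above
`k`. -/
lemma integral_rightPay_le_of_crossesAt (hg : IsRegularDensity β μ g) {c : ℝ}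
    (hc : CrossesAt β (cdf μ) g c) {U : ℝ → ℝ} (hU : IsIndirectUtility U) {k b α : ℝ}
    (hk : 0 ≤ k) (hkβ : k ≤ β) (hUk : U k = α * k - b)
    (hs : ∀ x, k ≤ x → α ≤ rightSlope U x) :
    ∫ x in k..β, rightPay U x * g x ≤
      b * (1 - cdf μ k) + (1 - α) * (max k c * (1 - cdf μ (max k c))) := by
  have hβ : 0 ≤ β := hk.trans hkβ
  obtain ⟨-, i1, e1⟩ := integral_rightPay_mul (H := fun x => cdf μ x - 1) hU hkβ
    ((hg.continuousOn_cdf.mono (Icc_subset_Icc hk le_rfl)).sub continuousOn_const)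
    (fun x hx => (hg.hasDerivAt_cdf ⟨hk.trans_lt hx.1, hx.2⟩).sub_const 1)
    (hg.intervalIntegrable ⟨hk, hkβ⟩ ⟨hβ, le_rfl⟩)
  set m := max k c with hm
  have hkm : k ≤ m := le_max_left _ _
  have hmβ : m ≤ β := max_le hkβ hc.mem.2.le
  have hm0 : 0 ≤ m := hk.trans hkm
  have q : ∀ {x y}, 0 ≤ x → x ≤ y → y ≤ β →
      IntervalIntegrable (fun x => x * g x + (cdf μ x - 1)) volume x y ∧
      ∫ x in x..y, (x * g x + (cdf μ x - 1)) = x * (1 - cdf μ x) - y * (1 - cdf μ y) := by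
    intro x y hx hxy hy
    obtain ⟨i, e⟩ := hg.integral_mul_add_cdf hx hxy hy
    have : (fun x => x * g x + (cdf μ x - 1)) = fun x => (x * g x + cdf μ x) - 1 := by
      ext; ring
    rw [this]
    refine ⟨i.sub (by simp), ?_⟩
    rw [intervalIntegral.integral_sub i (by simp), e]
    simp; ring
  obtain ⟨j1, q1⟩ := q hk hkm hmβ
  obtain ⟨j2, q2⟩ := q hm0 hmβ le_rfl
  have i10 : IntervalIntegrable (fun x => rightSlope U x * (x * g x + (cdf μ x - 1))) volume k m :=
    i1.mono_set (by rw [uIcc_of_le hkm, uIcc_of_le hkβ]; exact Icc_subset_Icc le_rfl hmβ)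
  have i11 : IntervalIntegrable (fun x => rightSlope U x * (x * g x + (cdf μ x - 1))) volume m β :=
    i1.mono_set (by rw [uIcc_of_le hmβ, uIcc_of_le hkβ]; exact Icc_subset_Icc hkm le_rfl)
  have b1 : ∫ x in k..m, rightSlope U x * (x * g x + (cdf μ x - 1)) ≤
      α * ∫ x in k..m, (x * g x + (cdf μ x - 1)) := by
    rw [← intervalIntegral.integral_const_mul]
    refine intervalIntegral.integral_mono_on_of_le_Ioo hkm i10 (j1.const_mul α) fun x hx => ?_
    have hxc : x < c := by
      rcases lt_max_iff.1 hx.2 with h | h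
      · exact absurd h hx.1.not_gt
      · exact h
    have := hc.neg x ⟨hk.trans_lt hx.1, hxc⟩
    exact mul_le_mul_of_nonpos_right (hs x hx.1.le) (by linarith)
  have b2 : ∫ x in m..β, rightSlope U x * (x * g x + (cdf μ x - 1)) ≤
      ∫ x in m..β, (x * g x + (cdf μ x - 1)) := by
    refine intervalIntegral.integral_mono_on_of_le_Ioo hmβ i11 j2 fun x hx => ?_
    have := hc.pos x ⟨(le_max_right _ _).trans_lt hx.1, hx.2⟩
    exact mul_le_of_le_one_left (by linarith) (hU.rightSlope_le_one x)
  rw [e1, ← intervalIntegral.integral_add_adjacent_intervals i10 i11, hg.cdf_right hβ, hUk]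
  rw [q1] at b1
  rw [q2, hg.cdf_right hβ] at b2
  linarith

end revenueBounds

/-! ### Indirect utilities of menus -/

/-- The supremum of the payoffs of the outcomes in `X` at the value `w`. -/
def supPayoff (X : Set (ℝ × ℝ)) (w : ℝ) : ℝ := sSup (payoff w '' X)

/-- A nonempty menu of allocation probabilities and payments that are bounded below. -/
structure IsMenu (X : Set (ℝ × ℝ)) : Prop where
  nonempty : X.Nonempty
  alloc_mem : ∀ z ∈ X, z.1 ∈ Icc (0 : ℝ) 1
  bddBelow : ∃ C, ∀ z ∈ X, C ≤ z.2

namespace IsMenu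

variable {X : Set (ℝ × ℝ)}

lemma payoff_le (hX : IsMenu X) (w : ℝ) {z : ℝ × ℝ} (hz : z ∈ X) :
    payoff w z ≤ supPayoff X w := by
  refine le_csSup ?_ (mem_image_of_mem _ hz)
  obtain ⟨C, hC⟩ := hX.bddBelow
  refine ⟨|w| - C, ?_⟩
  rintro _ ⟨y, hy, rfl⟩
  have h1 := hC y hy
  obtain ⟨h2, h3⟩ := hX.alloc_mem y hy
  have := le_abs_self w
  have := abs_nonneg w
  unfold payoff
  nlinarith

lemma supPayoff_le (hX : IsMenu X) {w c : ℝ} (h : ∀ z ∈ X, payoff w z ≤ c) :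
    supPayoff X w ≤ c := by
  refine csSup_le (hX.nonempty.image _) ?_
  rintro _ ⟨y, hy, rfl⟩
  exact h y hy

lemma isIndirectUtility (hX : IsMenu X) : IsIndirectUtility (supPayoff X) where
  convex := by
    refine ⟨convex_univ, fun x _ y _ a c ha hc hac => ?_⟩
    refine hX.supPayoff_le fun z hz => ?_
    have h1 := mul_le_mul_of_nonneg_left (hX.payoff_le x hz) ha
    have h2 := mul_le_mul_of_nonneg_left (hX.payoff_le y hz) hc
    simp only [smul_eq_mul]
    unfold payoff at *
    have : a * (x * z.1 - z.2) + c * (y * z.1 - z.2) =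
        (a * x + c * y) * z.1 - (a + c) * z.2 := by ring
    rw [hac] at this
    linarith
  mono := by
    intro x y hxy
    refine hX.supPayoff_le fun z hz => ?_
    have h1 := hX.payoff_le y hz
    have h2 := mul_le_mul_of_nonneg_right hxy (hX.alloc_mem z hz).1
    unfold payoff at *
    linarith
  slope_le := by
    intro x y hxy
    rw [sub_le_iff_le_add]
    refine hX.supPayoff_le fun z hz => ?_
    have h1 := hX.payoff_le x hz
    have h2 := mul_le_of_le_one_right (sub_nonneg.2 hxy) (hX.alloc_mem z hz).2
    unfold payoff at *
    linarith

lemma pay_le_rightPay (hX : IsMenu X) {w : ℝ} (hw : 0 ≤ w) {z : ℝ × ℝ} (hz : z ∈ choice X w) :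
    z.2 ≤ rightPay (supPayoff X) w := by
  refine hX.isIndirectUtility.le_rightPay (q := z.1) hw ?_ fun y => hX.payoff_le y hz.1
  exact le_antisymm (hX.supPayoff_le hz.2) (hX.payoff_le w hz.1)

/-- If some value just above `x` is served optimally with a payment of at most `b`, then the
rightmost payment at `x` is at most `b`. -/
lemma rightPay_le (hX : IsMenu X) {x y b : ℝ} (hx : 0 ≤ x) (hxy : x < y) {z : ℝ × ℝ}
    (hz : z ∈ choice X y) (hzb : z.2 ≤ b) : rightPay (supPayoff X) x ≤ b := by
  have h1 := hX.payoff_le x hz.1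
  have h2 : supPayoff X y ≤ payoff y z := hX.supPayoff_le hz.2
  have h3 := hX.isIndirectUtility.rightSlope_mul_le x y
  unfold rightPay
  unfold payoff at *
  have h4 : rightSlope (supPayoff X) x ≤ z.1 := by
    by_contra! h
    nlinarith [mul_pos (sub_pos.2 h) (sub_pos.2 hxy)]
  have := mul_le_mul_of_nonneg_left h4 hx
  linarith

lemma le_rightPay (hX : IsMenu X) {b : ℝ} (h : ∀ z ∈ X, b ≤ z.2) (x : ℝ) :
    b ≤ rightPay (supPayoff X) x := by
  have h1 := hX.isIndirectUtility.rightSlope_mul_le x 0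
  have h2 : supPayoff X 0 ≤ -b := hX.supPayoff_le fun z hz => by
    have := h z hz
    unfold payoff; linarith
  unfold rightPay
  linarith

end IsMenu

/-! ### Payments in incentive compatible mechanisms -/

lemma choice_budgetSet_nonempty {M : Mechanism} {β b : ℝ} (hIC : M.IsIC β b) {x : ℝ}
    (hx : x ∈ Icc 0 β) : (choice (budgetSet b (M.range β)) x).Nonempty := by
  have h := hIC (x, x) ⟨hx, hx, le_rfl⟩
  unfold pairChoice at h
  split_ifs at h with hs
  · obtain ⟨-, -, -, z, hz, -⟩ := hs
    exact ⟨z, hz⟩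
  · exact ⟨_, h⟩

lemma outcome_mem_choice_budgetSet {M : Mechanism} {β b : ℝ} (hIC : M.IsIC β b) {v : ℝ × ℝ}
    (hv : v ∈ typeSpace β) (hp : M.pay v ≤ b) :
    (M.alloc v, M.pay v) ∈ choice (budgetSet b (M.range β)) v.1 := by
  have h := hIC v hv
  unfold pairChoice at h
  split_ifs at h with hs
  · obtain ⟨z, hz⟩ := choice_budgetSet_nonempty hIC hv.1
    exact ⟨⟨h.1, hp⟩, fun z' hz' => (hz.2 z' hz').trans (hs.1 _ h _ hz)⟩
  · exact h

lemma outcome_mem_choice_range {M : Mechanism} {β b : ℝ} (hIC : M.IsIC β b) {v : ℝ × ℝ}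
    (hv : v ∈ typeSpace β) (hp : b < M.pay v) :
    (M.alloc v, M.pay v) ∈ choice (M.range β) v.2 := by
  have h := hIC v hv
  unfold pairChoice at h
  split_ifs at h with hs
  · exact h
  · exact absurd h.1.2 hp.not_ge

/-- The payments of an incentive compatible mechanism are dominated by those of the agent as long
as the principal's value is below a cutoff `k`, and by those of the principal above it. -/
lemma exists_indirectUtilities {M : Mechanism} {β b : ℝ} (hβ : 0 < β) (hb : 0 ≤ b)
    (hval : M.IsValid β) (hIC : M.IsIC β b) (hIR : M.IsIR β) :
    ∃ U₁, IsIndirectUtility U₁ ∧ 0 ≤ U₁ 0 ∧ (∀ x, 0 ≤ x → x < β → rightPay U₁ x ≤ b) ∧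
      ((∀ v ∈ typeSpace β, M.pay v ≤ rightPay U₁ v.1) ∨
        ∃ U₂ k, IsIndirectUtility U₂ ∧ (∀ x, b ≤ rightPay U₂ x) ∧ k ∈ Icc 0 β ∧ U₁ k = U₂ k ∧
          ∀ v ∈ typeSpace β, (v.2 < k → M.pay v ≤ b ∧ M.pay v ≤ rightPay U₁ v.1) ∧
            (k ≤ v.2 → M.pay v ≤ rightPay U₂ v.2)) := by
  set R := M.range β with hR
  have halloc : ∀ z ∈ R, z.1 ∈ Icc (0 : ℝ) 1 := by
    rintro _ ⟨v, hv, rfl⟩; exact hval v hv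
  have hX : IsMenu (budgetSet b R) := by
    refine ⟨⟨_, hIR, hb⟩, fun z hz => halloc z hz.1, ?_⟩
    obtain ⟨z, hz⟩ := choice_budgetSet_nonempty hIC ⟨le_rfl, hβ.le⟩
    refine ⟨z.2, fun z' hz' => ?_⟩
    have := hz.2 z' hz'
    unfold payoff at this
    linarith
  have hU0 : 0 ≤ supPayoff (budgetSet b R) 0 := by
    have := hX.payoff_le 0 (z := (0, 0)) ⟨hIR, hb⟩
    simpa [payoff] using this
  refine ⟨_, hX.isIndirectUtility, hU0, fun x hx hxβ => ?_, ?_⟩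
  · obtain ⟨z, hz⟩ := choice_budgetSet_nonempty hIC (x := β) ⟨hβ.le, le_rfl⟩
    exact hX.rightPay_le hx hxβ hz hz.1.2
  have hlow : ∀ v ∈ typeSpace β, M.pay v ≤ b →
      M.pay v ≤ rightPay (supPayoff (budgetSet b R)) v.1 := fun v hv hp =>
    hX.pay_le_rightPay hv.1.1 (outcome_mem_choice_budgetSet hIC hv hp)
  by_cases hex : ∃ v ∈ typeSpace β, b < M.pay v
  swap
  · push Not at hex
    exact Or.inl fun v hv => hlow v hv (hex v hv)
  right
  set Y : Set (ℝ × ℝ) := {z ∈ R | b < z.2} with hYdef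
  have hY : IsMenu Y := by
    obtain ⟨v, hv, hp⟩ := hex
    exact ⟨⟨_, mem_image_of_mem _ hv, hp⟩, fun z hz => halloc z hz.1, b, fun z hz => hz.2.le⟩
  have hhigh : ∀ v ∈ typeSpace β, b < M.pay v →
      M.pay v ≤ rightPay (supPayoff Y) v.2 ∧
        supPayoff (budgetSet b R) v.2 ≤ supPayoff Y v.2 := by
    intro v hv hp
    have h := outcome_mem_choice_range hIC hv hp
    refine ⟨hY.pay_le_rightPay hv.2.1.1 ⟨⟨h.1, hp⟩, fun z hz => h.2 z hz.1⟩, ?_⟩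
    exact hX.supPayoff_le fun z hz => (h.2 z hz.1).trans (hY.payoff_le _ ⟨h.1, hp⟩)
  have hc1 := hX.isIndirectUtility.continuous
  have hc2 := hY.isIndirectUtility.continuous
  have hbY : ∀ x, b ≤ rightPay (supPayoff Y) x := hY.le_rightPay fun z hz => hz.2.le
  have hY0 : supPayoff Y 0 ≤ supPayoff (budgetSet b R) 0 := by
    refine le_trans (hY.supPayoff_le fun z hz => ?_) hU0
    have : b < z.2 := hz.2
    unfold payoff
    linarith
  set S := Icc 0 β ∩ {x | supPayoff (budgetSet b R) x ≤ supPayoff Y x} with hS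
  have hSc : IsCompact S := isCompact_Icc.inter_right (isClosed_le hc1 hc2)
  have hSne : S.Nonempty := by
    obtain ⟨v, hv, hp⟩ := hex
    exact ⟨v.2, hv.2.1, (hhigh v hv hp).2⟩
  obtain ⟨k, hkS, hkmin⟩ := hSc.exists_isLeast hSne
  refine ⟨_, k, hY.isIndirectUtility, hbY, hkS.1, ?_, fun v hv => ⟨fun hvk => ?_, fun hvk => ?_⟩⟩
  · obtain ⟨x, hx, hxe⟩ := intermediate_value_Icc hkS.1.1 ((hc2.sub hc1).continuousOn)
      (show (0 : ℝ) ∈ Icc _ _ from ⟨sub_nonpos.2 hY0, sub_nonneg.2 hkS.2⟩)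
    simp only [Pi.sub_apply] at hxe
    have hxS : x ∈ S := ⟨⟨hx.1, hx.2.trans hkS.1.2⟩, by rw [mem_ofPred_eq]; linarith⟩
    have : x = k := le_antisymm hx.2 (hkmin hxS)
    subst this
    linarith
  · have hp : M.pay v ≤ b := by
      by_contra! hp
      exact hvk.not_ge (hkmin ⟨hv.2.1, (hhigh v hv hp).2⟩)
    exact ⟨hp, hlow v hv hp⟩
  · rcases le_or_gt (M.pay v) b with hp | hp
    · exact hp.trans (hbY _)
    · exact (hhigh v hv hp).1

/-! ### Expectations under the prior -/

lemma measurableSet_typeSpace (β : ℝ) : MeasurableSet (typeSpace β) := by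
  have : typeSpace β = (Icc 0 β ×ˢ Icc 0 β) ∩ {v : ℝ × ℝ | v.2 ≤ v.1} := by
    ext v; simp only [typeSpace, mem_ofPred_eq, mem_inter_iff, mem_prod, and_assoc]
  rw [this]
  exact (measurableSet_Icc.prod measurableSet_Icc).inter
    (measurableSet_le measurable_snd measurable_fst)

namespace IsPrior

variable {β : ℝ} {f : ℝ × ℝ → ℝ}

lemma integrable (hf : IsPrior β f) : Integrable f := by
  refine ⟨hf.measurable.aestronglyMeasurable, ?_⟩
  have h1 : law f univ = 1 := hf.isProbability.measure_univ
  rw [law, withDensity_apply _ MeasurableSet.univ, Measure.restrict_univ] at h1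
  rw [hasFiniteIntegral_iff_ofReal (Filter.Eventually.of_forall hf.nonneg), h1]
  exact ENNReal.one_lt_top

lemma isProbabilityMeasure_agentLaw (hf : IsPrior β f) : IsProbabilityMeasure (agentLaw f) :=
  haveI := hf.isProbability
  Measure.isProbabilityMeasure_map measurable_fst.aemeasurable

lemma isProbabilityMeasure_principalLaw (hf : IsPrior β f) :
    IsProbabilityMeasure (principalLaw f) :=
  haveI := hf.isProbability
  Measure.isProbabilityMeasure_map measurable_snd.aemeasurable

lemma integrableOn_comp_mul (hf : IsPrior β f) {π : ℝ × ℝ → ℝ} (hπ : Measurable π)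
    (hπV : ∀ v ∈ typeSpace β, π v ∈ Icc 0 β) {h : ℝ → ℝ} (hm : Measurable h) {C : ℝ}
    (hC : ∀ x ∈ Icc 0 β, |h x| ≤ C) : IntegrableOn (fun v => h (π v) * f v) (typeSpace β) := by
  refine Integrable.bdd_mul (c := C) hf.integrable.integrableOn
    (hm.comp hπ).aestronglyMeasurable ?_
  filter_upwards [ae_restrict_mem (measurableSet_typeSpace β)] with v hv
  exact hC _ (hπV v hv)

lemma setIntegral_comp_mul (hf : IsPrior β f) {π : ℝ × ℝ → ℝ} (hπ : Measurable π)
    {h : ℝ → ℝ} (hm : Measurable h) :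
    ∫ v in typeSpace β, h (π v) * f v = ∫ x, h x ∂((law f).map π) := by
  rw [integral_map hπ.aemeasurable hm.aestronglyMeasurable, law,
    integral_withDensity_eq_integral_toReal_smul hf.measurable.ennreal_ofReal (by simp),
    setIntegral_eq_integral_of_forall_compl_eq_zero
      fun v hv => by rw [hf.eq_zero v hv, mul_zero]]
  refine integral_congr_ae (Filter.Eventually.of_forall fun v => ?_)
  simp only [ENNReal.toReal_ofReal (hf.nonneg v), smul_eq_mul, mul_comm]

lemma setIntegral_add_mul (hf : IsPrior β f) {f₁ f₂ : ℝ → ℝ}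
    (hf₁ : IsRegularDensity β (agentLaw f) f₁) (hf₂ : IsRegularDensity β (principalLaw f) f₂)
    {h₁ h₂ : ℝ → ℝ} (hm₁ : Measurable h₁) (hm₂ : Measurable h₂) {C : ℝ}
    (hC₁ : ∀ x ∈ Icc 0 β, |h₁ x| ≤ C) (hC₂ : ∀ x ∈ Icc 0 β, |h₂ x| ≤ C) :
    IntegrableOn (fun v => (h₁ v.1 + h₂ v.2) * f v) (typeSpace β) ∧
    ∫ v in typeSpace β, (h₁ v.1 + h₂ v.2) * f v =
      (∫ x in Icc 0 β, h₁ x * f₁ x) + ∫ x in Icc 0 β, h₂ x * f₂ x := by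
  have i1 := hf.integrableOn_comp_mul measurable_fst (fun v hv => hv.1) hm₁ hC₁
  have i2 := hf.integrableOn_comp_mul measurable_snd (fun v hv => hv.2.1) hm₂ hC₂
  simp_rw [add_mul]
  refine ⟨i1.add i2, ?_⟩
  rw [integral_add i1 i2, hf.setIntegral_comp_mul measurable_fst hm₁,
    hf.setIntegral_comp_mul measurable_snd hm₂, ← hf₁.integral_eq, ← hf₂.integral_eq]
  rfl

end IsPrior

lemma setIntegral_Icc_eq_add {β k : ℝ} (hk : k ∈ Icc 0 β) {h p q : ℝ → ℝ}
    (hp : ∀ x ∈ Ioo 0 k, h x = p x) (hq : ∀ x ∈ Ioo k β, h x = q x)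
    (ip : IntervalIntegrable p volume 0 k) (iq : IntervalIntegrable q volume k β) :
    ∫ x in Icc 0 β, h x = (∫ x in (0 : ℝ)..k, p x) + ∫ x in k..β, q x := by
  have i1 : IntervalIntegrable h volume 0 k :=
    ip.congr_uIoo fun x hx => (hp x (by rwa [uIoo_of_le hk.1] at hx)).symm
  have i2 : IntervalIntegrable h volume k β :=
    iq.congr_uIoo fun x hx => (hq x (by rwa [uIoo_of_le hk.2] at hx)).symm
  rw [integral_Icc_eq_integral_Ioc, ← intervalIntegral.integral_of_le (hk.1.trans hk.2),
    ← intervalIntegral.integral_add_adjacent_intervals i1 i2,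
    intervalIntegral.integral_congr_Ioo_of_le hk.1 hp,
    intervalIntegral.integral_congr_Ioo_of_le hk.2 hq]

lemma IsRegularDensity.integral_const_mul {β : ℝ} {μ : Measure ℝ} [IsProbabilityMeasure μ]
    {g : ℝ → ℝ} (hg : IsRegularDensity β μ g) {k : ℝ} (hk : k ∈ Icc 0 β) (c : ℝ) :
    ∫ x in k..β, c * g x = c * (1 - ProbabilityTheory.cdf μ k) := by
  have hβ : 0 ≤ β := hk.1.trans hk.2
  have h0 : (0 : ℝ) ∈ Icc 0 β := ⟨le_rfl, hβ⟩
  have hb : β ∈ Icc 0 β := ⟨hβ, le_rfl⟩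
  rw [intervalIntegral.integral_const_mul, ← hg.cdf_right hβ, hg.cdf_eq_integral hb,
    hg.cdf_eq_integral hk, ← intervalIntegral.integral_add_adjacent_intervals
      (hg.intervalIntegrable h0 hk) (hg.intervalIntegrable hk hb)]
  ring

lemma IsRegularDensity.setIntegral_step_mul {β : ℝ} {μ : Measure ℝ} [IsProbabilityMeasure μ]
    {g : ℝ → ℝ} (hg : IsRegularDensity β μ g) {k c : ℝ} (hk : k ∈ Icc 0 β) {h : ℝ → ℝ}
    (h0 : ∀ x < k, h x = 0) (hc : ∀ x > k, h x = c) :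
    ∫ x in Icc 0 β, h x * g x = c * (1 - ProbabilityTheory.cdf μ k) := by
  rw [setIntegral_Icc_eq_add (p := fun _ => 0) (q := fun x => c * g x) hk
    (fun x hx => by rw [h0 x hx.2, zero_mul]) (fun x hx => by rw [hc x hx.1]) (by simp)
    ((hg.intervalIntegrable hk ⟨hk.1.trans hk.2, le_rfl⟩).const_mul c), hg.integral_const_mul hk]
  simp

/-! ### The revenue bound -/

lemma exists_alloc_price {k b u : ℝ} (hb : 0 ≤ b) (hu : 0 ≤ u) (hk : b + u ≤ k) :
    ∃ α y, 0 ≤ α ∧ α ≤ 1 ∧ 0 ≤ y ∧ y ≤ k ∧ α * y = b ∧ u = α * (k - y) ∧ (k = 0 → α = 0) := by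
  have hk0 : 0 ≤ k := (add_nonneg hb hu).trans hk
  rcases hk0.eq_or_lt with rfl | hkpos
  · exact ⟨0, 0, le_rfl, zero_le_one, le_rfl, le_rfl, by linarith, by linarith, fun _ => rfl⟩
  have hα0 : 0 ≤ (b + u) / k := div_nonneg (add_nonneg hb hu) hk0
  have hαk : (b + u) / k * k = b + u := div_mul_cancel₀ _ hkpos.ne'
  rcases hα0.eq_or_lt with h | h
  · rw [← h, zero_mul] at hαk
    exact ⟨0, 0, le_rfl, zero_le_one, le_rfl, hk0, by linarith, by linarith, fun _ => rfl⟩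
  · have hαb : (b + u) / k * (b / ((b + u) / k)) = b := mul_div_cancel₀ _ h.ne'
    refine ⟨(b + u) / k, b / ((b + u) / k), hα0, (div_le_one hkpos).2 hk, div_nonneg hb hα0, ?_,
      hαb, ?_, fun h0 => absurd h0 hkpos.ne'⟩
    · rw [div_le_iff₀ h, mul_comm, hαk]; linarith
    · rw [mul_sub, hαb, hαk]; ring

lemma IsIndirectUtility.rightSlope_le_of_rightPay_le {U : ℝ → ℝ} (hU : IsIndirectUtility U)
    {x k b α : ℝ} (hx : 0 ≤ x) (hxk : x < k) (hT : rightPay U x ≤ b) (hα : α * k = b + U k) :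
    rightSlope U x ≤ α := by
  have h1 := hU.rightSlope_mul_le x k
  unfold rightPay at hT
  by_contra! h
  nlinarith [mul_pos (sub_pos.2 h) (hx.trans_lt hxk)]

lemma le_max_of_le_of_isMaxOn {β κ x y : ℝ} {r : ℝ → ℝ} (hr : ConcaveOn ℝ (Icc 0 β) r)
    (hκ : κ ∈ Icc 0 β) (hmax : IsMaxOn r (Icc 0 β) κ) (hx : 0 ≤ x) (hxy : x ≤ y) (hy : y ≤ κ) :
    r x ≤ r y := by
  have hxI : x ∈ Icc 0 β := ⟨hx, hxy.trans (hy.trans hκ.2)⟩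
  have := hr.min_le_of_mem_Icc hxI hκ ⟨hxy, hy⟩
  rwa [min_eq_left (hmax hxI)] at this

section bound

variable {β b : ℝ} {f : ℝ × ℝ → ℝ} {f₁ f₂ : ℝ → ℝ}

/-- The revenue of every feasible mechanism is at most the revenue of the POST-1 mechanism with
price `b` or that of a POST-2 mechanism. -/
lemma revenue_le (hβ : 0 < β) (hb : 0 ≤ b) (hf : IsPrior β f)
    (hf₁ : IsRegularDensity β (agentLaw f) f₁) (hf₂ : IsRegularDensity β (principalLaw f) f₂)
    (hconc : ConcaveOn ℝ (Icc 0 β) (fun x => x * (1 - agentCDF f x)))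
    {c : ℝ} (hc : CrossesAt β (principalCDF f) f₂ c) {κ₁ : ℝ}
    (hκ₁ : IsMonopolyPrice β (agentCDF f) κ₁) (hbκ₁ : b < κ₁)
    {M : Mechanism} (hM : M.IsFeasible β b f) :
    M.revenue β f ≤ b * (1 - agentCDF f b) ∨
      ∃ α y k, 0 ≤ α ∧ α ≤ 1 ∧ 0 ≤ y ∧ y ≤ k ∧ k ≤ β ∧ α * y = b ∧
        M.revenue β f ≤ b * (1 - agentCDF f y) +
          (1 - α) * (max k c * (1 - principalCDF f (max k c))) := by
  have := hf.isProbabilityMeasure_agentLaw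
  have := hf.isProbabilityMeasure_principalLaw
  obtain ⟨hval, hIC, hIR, hint⟩ := hM
  have h0 : (0 : ℝ) ∈ Icc 0 β := ⟨le_rfl, hβ.le⟩
  have hbI : β ∈ Icc 0 β := ⟨hβ.le, le_rfl⟩
  have hrev : ∀ {h₁ h₂ : ℝ → ℝ} {C : ℝ}, Measurable h₁ → Measurable h₂ →
      (∀ x ∈ Icc 0 β, |h₁ x| ≤ C) → (∀ x ∈ Icc 0 β, |h₂ x| ≤ C) →
      (∀ v ∈ typeSpace β, M.pay v ≤ h₁ v.1 + h₂ v.2) →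
      M.revenue β f ≤ (∫ x in Icc 0 β, h₁ x * f₁ x) + ∫ x in Icc 0 β, h₂ x * f₂ x := by
    intro h₁ h₂ C hm₁ hm₂ hC₁ hC₂ hle
    obtain ⟨i, e⟩ := hf.setIntegral_add_mul hf₁ hf₂ hm₁ hm₂ hC₁ hC₂
    rw [← e]
    exact setIntegral_mono_on hint i (measurableSet_typeSpace β)
      fun v hv => mul_le_mul_of_nonneg_right (hle v hv) (hf.nonneg v)
  have hF1 : agentCDF f β = 1 := hf₁.cdf_right hβ.le
  have hparts := fun {U : ℝ → ℝ} (hU : IsIndirectUtility U) {k : ℝ} (hk : k ∈ Icc 0 β) =>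
    (integral_rightPay_mul hU hk.1 (hf₁.continuousOn_cdf.mono (Icc_subset_Icc le_rfl hk.2))
      (fun x hx => hf₁.hasDerivAt_cdf ⟨hx.1, hx.2.trans_le hk.2⟩)
      (hf₁.intervalIntegrable h0 hk)).1
  obtain ⟨U₁, hU₁, hU0, hT₁, hall | ⟨U₂, k, hU₂, hT₂, hk, hUk, hpay⟩⟩ :=
    exists_indirectUtilities hβ hb hval hIC hIR
  · left
    have hr : M.revenue β f ≤ ∫ x in (0 : ℝ)..β, rightPay U₁ x * f₁ x := by
      have := hrev hU₁.measurable_rightPay (measurable_const (a := (0 : ℝ)))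
        (fun x hx => hU₁.abs_rightPay_le hx) (fun x _ => by rw [abs_zero]; positivity)
        (fun v hv => by simpa using hall v hv)
      rw [intervalIntegral.integral_of_le hβ.le, ← integral_Icc_eq_integral_Ioc]
      simpa using this
    refine hr.trans ?_
    have hbβ : b ≤ β := hbκ₁.le.trans hκ₁.1.2
    rcases lt_or_ge β (U₁ β) with hu | hu
    · have : ∫ x in (0 : ℝ)..β, rightPay U₁ x * f₁ x ≤ ∫ _ in (0 : ℝ)..β, (0 : ℝ) := by
        refine intervalIntegral.integral_mono_on_of_le_Ioo hβ.le (hparts hU₁ hbI) (by simp)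
          fun x hx => mul_nonpos_of_nonpos_of_nonneg ?_ (hf₁.pos x hx).le
        have h1 := hU₁.slope_le hx.2.le
        have h2 := mul_le_of_le_one_right hx.1.le (hU₁.rightSlope_le_one x)
        unfold rightPay
        linarith
      refine this.trans ?_
      simp only [intervalIntegral.integral_zero]
      exact mul_nonneg hb (sub_nonneg.2 (ProbabilityTheory.cdf_le_one _ _))
    rcases le_or_gt (β - U₁ β) b with hu' | hu'
    · have hUβ : 0 ≤ U₁ β := hU0.trans (hU₁.mono hβ.le)
      have := integral_rightPay_le_of_concaveOn hf₁ hconc hU₁ hU0 (y := β - U₁ β) (α := 1)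
        (by linarith) (by linarith) le_rfl (by ring) fun x _ _ => hU₁.rightSlope_le_one x
      rw [hf₁.cdf_right hβ.le, one_mul] at this
      exact this.trans
        (le_max_of_le_of_isMaxOn hconc hκ₁.1 hκ₁.2 (by linarith) hu' hbκ₁.le)
    · obtain ⟨α, y, hα0, hα1, hy0, hyβ, hαy, hu, -⟩ := exists_alloc_price hb
        (hU0.trans (hU₁.mono hβ.le)) (show b + U₁ β ≤ β by linarith)
      have := integral_rightPay_le_of_concaveOn hf₁ hconc hU₁ hU0 hy0 hyβ le_rfl hu
        fun x hx hxβ => hU₁.rightSlope_le_of_rightPay_le hx hxβ (hT₁ x hx hxβ)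
          (by rw [hu, ← hαy]; ring)
      rw [hf₁.cdf_right hβ.le, hαy] at this
      refine this.trans (mul_le_mul_of_nonneg_left ?_ hb)
      have hby : b ≤ y := by rw [← hαy]; exact mul_le_of_le_one_left hy0 hα1
      exact sub_le_sub_left (ProbabilityTheory.monotone_cdf _ hby) _
  · right
    have hbk : b + U₁ k ≤ k := by
      have h1 := hT₂ k
      have h2 := mul_le_of_le_one_right hk.1 (hU₂.rightSlope_le_one k)
      unfold rightPay at h1
      linarith
    obtain ⟨α, y, hα0, hα1, hy0, hyk, hαy, hu, hα⟩ := exists_alloc_price hb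
      (hU0.trans (hU₁.mono hk.1)) hbk
    have hαk : α * k = b + U₁ k := by rw [hu, ← hαy]; ring
    refine ⟨α, y, k, hα0, hα1, hy0, hyk, hk.2, hαy, ?_⟩
    have E1 := integral_rightPay_le_of_concaveOn hf₁ hconc hU₁ hU0 hy0 hyk hk.2 hu
      fun x hx hxk => hU₁.rightSlope_le_of_rightPay_le hx hxk (hT₁ x hx (hxk.trans_le hk.2)) hαk
    have E2 := integral_rightPay_le_of_crossesAt (α := α) (b := b) hf₂ hc hU₂ hk.1 hk.2
      (by linarith) fun x hx => by
        refine le_trans ?_ (hU₂.monotone_rightSlope hx)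
        rcases hk.1.eq_or_lt with h | h
        · rw [hα h.symm]; exact hU₂.rightSlope_nonneg k
        · have h1 := hT₂ k
          unfold rightPay at h1
          by_contra! h2
          nlinarith [mul_pos (sub_pos.2 h2) h]
    set C := (β + (|U₁ 0| + |U₁ β|)) + (β + (|U₂ 0| + |U₂ β|)) + b with hC
    have := hrev (h₁ := fun x => if x < k then rightPay U₁ x else b)
      (h₂ := fun x => if x < k then 0 else rightPay U₂ x - b) (C := C)
      (Measurable.ite measurableSet_Iio hU₁.measurable_rightPay measurable_const)
      (Measurable.ite measurableSet_Iio measurable_const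
        (hU₂.measurable_rightPay.sub_const b))
      (fun x hx => by
        have h1 := hU₁.abs_rightPay_le hx
        split_ifs
        · exact h1.trans (by rw [hC, add_assoc]; exact le_add_of_nonneg_right (by positivity))
        · rw [abs_of_nonneg hb]; exact le_add_of_nonneg_left (by positivity))
      (fun x hx => by
        have h1 := hU₂.abs_rightPay_le hx
        split_ifs
        · rw [abs_zero]; positivity
        · refine (abs_sub _ _).trans ?_
          rw [abs_of_nonneg hb, hC]
          have : 0 ≤ β + (|U₁ 0| + |U₁ β|) := by positivity
          linarith)
      (fun v hv => by
        obtain ⟨h1, h2⟩ := hpay v hv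
        rcases lt_or_ge v.2 k with hvk | hvk
        · rw [if_pos hvk, add_zero]
          split_ifs
          · exact (h1 hvk).2
          · exact (h1 hvk).1
        · rw [if_neg hvk.not_gt, if_neg (hvk.trans hv.2.2).not_gt]
          linarith [h2 hvk])
    refine this.trans ?_
    have ib1 := (hf₁.intervalIntegrable hk hbI).const_mul b
    have ib2 := (hf₂.intervalIntegrable hk hbI).const_mul b
    have iT2 := (integral_rightPay_mul hU₂ hk.2
      (hf₂.continuousOn_cdf.mono (Icc_subset_Icc hk.1 le_rfl))
      (fun x hx => hf₂.hasDerivAt_cdf ⟨hk.1.trans_lt hx.1, hx.2⟩)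
      (hf₂.intervalIntegrable hk hbI)).1
    rw [setIntegral_Icc_eq_add (p := fun x => rightPay U₁ x * f₁ x) (q := fun x => b * f₁ x) hk
        (fun x hx => by rw [if_pos hx.2]) (fun x hx => by rw [if_neg hx.1.not_gt])
        (hparts hU₁ hk) ib1,
      setIntegral_Icc_eq_add (p := fun _ => 0) (q := fun x => rightPay U₂ x * f₂ x - b * f₂ x) hk
        (fun x hx => by rw [if_pos hx.2, zero_mul])
        (fun x hx => by rw [if_neg hx.1.not_gt, sub_mul]) (by simp) (iT2.sub ib2),
      hf₁.integral_const_mul hk, intervalIntegral.integral_sub iT2 ib2, hf₂.integral_const_mul hk,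
      intervalIntegral.integral_zero]
    rw [hαy] at E1
    unfold agentCDF principalCDF
    linarith

end bound

/-! ### Feasibility and revenue of POST mechanisms -/

section post

variable {β b κ : ℝ}

lemma mem_range_uniformPost2 (hκ0 : 0 < κ) (hκβ : κ < β) (z : ℝ × ℝ) :
    z ∈ (uniformPost2 b κ).range β ↔ z = (0, 0) ∨ z = (b / κ, b) ∨ z = (1, κ) := by
  have hβ : 0 < β := hκ0.trans hκβ
  have e : b + κ * (1 - b / κ) = κ := by field_simp; ring
  constructor
  · rintro ⟨v, -, rfl⟩
    simp only [uniformPost2, post2, e]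
    split_ifs <;> simp
  · rintro (rfl | rfl | rfl)
    · exact ⟨(0, 0), ⟨⟨le_rfl, hβ.le⟩, ⟨le_rfl, hβ.le⟩, le_rfl⟩, by
        simp [uniformPost2, post2, hκ0]⟩
    · exact ⟨(β, 0), ⟨⟨hβ.le, le_rfl⟩, ⟨le_rfl, hβ.le⟩, hβ.le⟩, by
        simp [uniformPost2, post2, hκ0.not_gt, hκβ.not_gt]⟩
    · exact ⟨(β, β), ⟨⟨hβ.le, le_rfl⟩, ⟨hβ.le, le_rfl⟩, le_rfl⟩, by
        simp [uniformPost2, post2, hκβ, hκβ.not_gt, e]⟩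

lemma isIC_uniformPost2 (hb : 0 ≤ b) (hκ0 : 0 < κ) (hbκ : b ≤ κ) (hκβ : κ < β) :
    (uniformPost2 b κ).IsIC β b := by
  intro v hv
  have hR := mem_range_uniformPost2 (b := b) hκ0 hκβ
  set R := (uniformPost2 b κ).range β
  have e : b + κ * (1 - b / κ) = κ := by field_simp; ring
  have ha0 : 0 ≤ b / κ := div_nonneg hb hκ0.le
  have ha1 : b / κ ≤ 1 := (div_le_one hκ0).2 hbκ
  have hab : κ * (b / κ) = b := mul_div_cancel₀ _ hκ0.ne'
  simp only [uniformPost2, post2, e]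
  set a := b / κ
  have p0 : ∀ w, payoff w (0, 0) = 0 := fun w => by simp [payoff]
  have pa : ∀ w, payoff w (a, b) = (w - κ) * a := fun w => by simp only [payoff]; linarith
  have p1 : ∀ w, payoff w (1, κ) = w - κ := fun w => by simp [payoff]
  have zero_mem : ∀ {w}, w ≤ κ → (0, 0) ∈ choice R w := by
    refine fun {w} hw => ⟨(hR _).2 (Or.inl rfl), fun z hz => ?_⟩
    rw [p0]
    obtain rfl | rfl | rfl := (hR z).1 hz
    · exact (p0 w).le
    · rw [pa]; exact mul_nonpos_of_nonpos_of_nonneg (by linarith) ha0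
    · rw [p1]; linarith
  have mid_mem : κ ≤ v.1 → (a, b) ∈ choice (budgetSet b R) v.1 := by
    refine fun h => ⟨⟨(hR _).2 (Or.inr (Or.inl rfl)), le_rfl⟩, fun z hz => ?_⟩
    rw [pa]
    obtain rfl | rfl | rfl := (hR z).1 hz.1
    · rw [p0]; exact mul_nonneg (by linarith) ha0
    · exact (pa _).le
    · have : b = κ := le_antisymm hbκ hz.2
      have : a = 1 := by
        rw [this] at hab; exact mul_left_cancel₀ hκ0.ne' (by linarith)
      rw [p1, this, mul_one]
  unfold pairChoice
  rcases lt_or_ge v.1 κ with h1 | h1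
  · simp only [if_pos h1]
    split_ifs
    · exact zero_mem (hv.2.2.trans h1.le)
    · exact ⟨⟨(zero_mem h1.le).1, hb⟩, fun z hz => (zero_mem h1.le).2 z hz.1⟩
  simp only [if_neg h1.not_gt]
  rcases lt_or_ge κ v.2 with h2 | h2
  · simp only [if_pos h2]
    have one_mem : ∀ {w}, κ ≤ w → (1, κ) ∈ choice R w := by
      refine fun {w} hw => ⟨(hR _).2 (Or.inr (Or.inr rfl)), fun z hz => ?_⟩
      rw [p1]
      obtain rfl | rfl | rfl := (hR z).1 hz
      · rw [p0]; linarith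
      · rw [pa]; exact mul_le_of_le_one_right (by linarith) ha1
      · exact (p1 _).le
    split_ifs with hs
    · exact one_mem h2.le
    rcases hbκ.eq_or_lt with h3 | h3
    · exact ⟨⟨(one_mem h1).1, h3.ge⟩, fun z hz => (one_mem h1).2 z hz.1⟩
    exfalso
    have ha : a < 1 := (div_lt_one hκ0).2 h3
    refine hs ⟨fun z hz z' hz' => ?_, _, one_mem h2.le, _, mid_mem h1, ?_⟩
    · have hz1 : z = (1, κ) := by
        have := hz.2 _ (one_mem h2.le).1
        rw [p1] at this
        obtain rfl | rfl | rfl := (hR z).1 hz.1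
        · rw [p0] at this; linarith
        · rw [pa] at this; nlinarith
        · rfl
      rw [hz1]
      exact (one_mem h1).2 z' hz'.1.1
    · rw [pa, p1]; nlinarith [hv.2.2]
  · simp only [if_neg h2.not_gt]
    split_ifs with hs
    swap
    · exact mid_mem h1
    have h3 := hs.1 _ (zero_mem h2) _ (mid_mem h1)
    rw [p0, pa] at h3
    rcases ha0.eq_or_lt with h4 | h4
    · rw [← h4, mul_zero] at hab
      rw [← h4, ← hab]
      exact zero_mem h2
    · exfalso
      have h5 : v.1 = κ := by
        refine le_antisymm ?_ h1
        by_contra! h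
        nlinarith
      have hz0 : ∀ z ∈ R, payoff v.1 z = 0 := by
        intro z hz
        obtain rfl | rfl | rfl := (hR z).1 hz
        · exact p0 _
        · rw [pa, h5, sub_self, zero_mul]
        · rw [p1, h5, sub_self]
      obtain ⟨-, z, hz, z', hz', hlt⟩ := hs
      rw [hz0 z hz.1, hz0 z' hz'.1.1] at hlt
      exact lt_irrefl _ hlt

lemma isIC_post1 (hb : 0 ≤ b) (hbβ : b < β) : (post1 b).IsIC β b := by
  intro v hv
  have hβ : 0 < β := hb.trans_lt hbβ
  have hR : ∀ z, z ∈ (post1 b).range β ↔ z = (0, 0) ∨ z = (1, b) := by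
    intro z
    constructor
    · rintro ⟨v, -, rfl⟩
      simp only [post1]
      split_ifs <;> simp
    · rintro (rfl | rfl)
      · exact ⟨(0, 0), ⟨⟨le_rfl, hβ.le⟩, ⟨le_rfl, hβ.le⟩, le_rfl⟩, by simp [post1, hb]⟩
      · exact ⟨(β, β), ⟨⟨hβ.le, le_rfl⟩, ⟨hβ.le, le_rfl⟩, le_rfl⟩, by
          simp [post1, hbβ.not_ge]⟩
  set R := (post1 b).range β
  have hRb : budgetSet b R = R := by
    refine sep_eq_self_iff_mem_true.2 fun z hz => ?_
    obtain rfl | rfl := (hR z).1 hz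
    · exact hb
    · exact le_rfl
  unfold pairChoice
  rw [hRb, if_neg]
  · refine ⟨mem_image_of_mem _ hv, fun z hz => ?_⟩
    simp only [post1]
    obtain rfl | rfl := (hR z).1 hz <;> split_ifs with h <;> simp only [payoff] <;> linarith
  · rintro ⟨-, z, hz, z', hz', hlt⟩
    exact (hz'.2 z hz.1).not_gt hlt

variable {f : ℝ × ℝ → ℝ} {f₁ f₂ : ℝ → ℝ}

lemma uniformPost2_isFeasible_and_revenue (hf : IsPrior β f)
    (hf₁ : IsRegularDensity β (agentLaw f) f₁) (hf₂ : IsRegularDensity β (principalLaw f) f₂)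
    (hb : 0 ≤ b) (hκ0 : 0 < κ) (hbκ : b ≤ κ) (hκβ : κ < β) :
    (uniformPost2 b κ).IsFeasible β b f ∧ (uniformPost2 b κ).revenue β f =
      b * (1 - agentCDF f κ) + (κ - b) * (1 - principalCDF f κ) := by
  have := hf.isProbabilityMeasure_agentLaw
  have := hf.isProbabilityMeasure_principalLaw
  have e : b + κ * (1 - b / κ) = κ := by field_simp; ring
  have hκI : κ ∈ Icc 0 β := ⟨hκ0.le, hκβ.le⟩
  have hpay : EqOn (fun v : ℝ × ℝ => ((if v.1 < κ then 0 else b) +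
      if v.2 ≤ κ then 0 else κ - b) * f v)
      (fun v => (uniformPost2 b κ).pay v * f v) (typeSpace β) := by
    intro v hv
    have := hv.2.2
    simp only [uniformPost2, post2, e]
    congr 1
    split_ifs <;> linarith
  obtain ⟨i, r⟩ := hf.setIntegral_add_mul hf₁ hf₂ (h₁ := fun x => if x < κ then 0 else b)
    (h₂ := fun x => if x ≤ κ then 0 else κ - b) (C := κ)
    (Measurable.ite measurableSet_Iio measurable_const measurable_const)
    (Measurable.ite measurableSet_Iic measurable_const measurable_const)
    (fun x _ => by
      split_ifs
      · rw [abs_zero]; exact hκ0.le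
      · rwa [abs_of_nonneg hb])
    (fun x _ => by
      split_ifs
      · rw [abs_zero]; exact hκ0.le
      · rw [abs_of_nonneg (by linarith)]; linarith)
  refine ⟨⟨fun v _ => ?_, isIC_uniformPost2 hb hκ0 hbκ hκβ,
    (mem_range_uniformPost2 hκ0 hκβ _).2 (Or.inl rfl),
    i.congr_fun hpay (measurableSet_typeSpace β)⟩, ?_⟩
  · simp only [uniformPost2, post2]
    split_ifs
    · simp
    · simp
    · exact ⟨div_nonneg hb hκ0.le, (div_le_one hκ0).2 hbκ⟩
  · unfold Mechanism.revenue
    rw [← setIntegral_congr_fun (measurableSet_typeSpace β) hpay, r,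
      hf₁.setIntegral_step_mul hκI (c := b) (fun x hx => if_pos hx)
        (fun x hx => if_neg (not_lt.2 (le_of_lt hx))),
      hf₂.setIntegral_step_mul hκI (c := κ - b) (fun x hx => if_pos hx.le)
        (fun x hx => if_neg (not_le.2 hx))]
    rfl

lemma post1_isFeasible_and_revenue (hf : IsPrior β f)
    (hf₁ : IsRegularDensity β (agentLaw f) f₁) (hf₂ : IsRegularDensity β (principalLaw f) f₂)
    (hb : 0 ≤ b) (hbβ : b < β) :
    (post1 b).IsFeasible β b f ∧ (post1 b).revenue β f = b * (1 - agentCDF f b) := by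
  have := hf.isProbabilityMeasure_agentLaw
  have hβ : 0 ≤ β := hb.trans hbβ.le
  obtain ⟨i, r⟩ := hf.setIntegral_add_mul hf₁ hf₂ (h₁ := fun x => if x ≤ b then 0 else b)
    (h₂ := fun _ => 0) (C := b)
    (Measurable.ite measurableSet_Iic measurable_const measurable_const) measurable_const
    (fun x _ => by
      split_ifs
      · rwa [abs_zero]
      · rw [abs_of_nonneg hb])
    (fun x _ => by rwa [abs_zero])
  simp only [add_zero] at i r
  refine ⟨⟨fun v _ => ?_, isIC_post1 hb hbβ, ?_, i⟩, ?_⟩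
  · simp only [post1]
    split_ifs <;> simp
  · exact ⟨(0, 0), ⟨⟨le_rfl, hβ⟩, ⟨le_rfl, hβ⟩, le_rfl⟩, by simp [post1, hb]⟩
  · refine r.trans ?_
    rw [hf₁.setIntegral_step_mul ⟨hb, hbβ.le⟩ (c := b) (fun x hx => if_pos hx.le)
        (fun x hx => if_neg (not_le.2 hx))]
    simp [agentCDF]

end post

/-! ### The optimal price -/

lemma CrossesAt.strictMonoOn {β c : ℝ} {μ : Measure ℝ} [IsProbabilityMeasure μ] {g : ℝ → ℝ}
    (hc : CrossesAt β (ProbabilityTheory.cdf μ) g c) (hg : IsRegularDensity β μ g) :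
    StrictMonoOn (fun x => x * (1 - ProbabilityTheory.cdf μ x)) (Icc 0 c) := by
  refine strictMonoOn_of_deriv_pos (convex_Icc 0 c) (continuousOn_id.mul
    (continuousOn_const.sub (hg.continuousOn_cdf.mono (Icc_subset_Icc le_rfl hc.mem.2.le))))
    fun x hx => ?_
  rw [interior_Icc] at hx
  rw [(hg.hasDerivAt_monopolyRevenue ⟨hx.1, hx.2.trans hc.mem.2⟩).deriv]
  linarith [hc.neg x hx]

lemma CrossesAt.strictAntiOn {β c : ℝ} {μ : Measure ℝ} [IsProbabilityMeasure μ] {g : ℝ → ℝ}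
    (hc : CrossesAt β (ProbabilityTheory.cdf μ) g c) (hg : IsRegularDensity β μ g) :
    StrictAntiOn (fun x => x * (1 - ProbabilityTheory.cdf μ x)) (Icc c β) := by
  refine strictAntiOn_of_deriv_neg (convex_Icc c β) (continuousOn_id.mul
    (continuousOn_const.sub (hg.continuousOn_cdf.mono (Icc_subset_Icc hc.mem.1.le le_rfl))))
    fun x hx => ?_
  rw [interior_Icc] at hx
  rw [(hg.hasDerivAt_monopolyRevenue ⟨hc.mem.1.trans hx.1, hx.2⟩).deriv]
  linarith [hc.pos x hx]

/-- The crossing point is the monopoly price. -/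
lemma CrossesAt.eq_of_isMonopolyPrice {β c κ : ℝ} {μ : Measure ℝ} [IsProbabilityMeasure μ]
    {g : ℝ → ℝ} (hc : CrossesAt β (ProbabilityTheory.cdf μ) g c) (hg : IsRegularDensity β μ g)
    (hκ : IsMonopolyPrice β (ProbabilityTheory.cdf μ) κ) : κ = c := by
  have h := hκ.2 (Ioo_subset_Icc_self hc.mem)
  rcases lt_trichotomy κ c with h1 | h1 | h1
  · exact absurd h (hc.strictMonoOn hg ⟨hκ.1.1, h1.le⟩ ⟨hc.mem.1.le, le_rfl⟩ h1).not_ge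
  · exact h1
  · exact absurd h (hc.strictAntiOn hg ⟨le_rfl, hc.mem.2.le⟩ ⟨h1.le, hκ.1.2⟩ h1).not_ge

section price

variable {β b : ℝ} {f : ℝ × ℝ → ℝ} {f₁ f₂ : ℝ → ℝ}

/-- The revenue of the uniform POST-2 mechanism with price `x`. -/
def uniformRevenue (b : ℝ) (f : ℝ × ℝ → ℝ) (x : ℝ) : ℝ :=
  b * (1 - agentCDF f x) + (x - b) * (1 - principalCDF f x)

lemma continuousOn_uniformRevenue (hf : IsPrior β f)
    (hf₁ : IsRegularDensity β (agentLaw f) f₁) (hf₂ : IsRegularDensity β (principalLaw f) f₂) :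
    ContinuousOn (uniformRevenue b f) (Icc 0 β) := by
  have := hf.isProbabilityMeasure_agentLaw
  have := hf.isProbabilityMeasure_principalLaw
  exact (continuousOn_const.mul (continuousOn_const.sub hf₁.continuousOn_cdf)).add
    ((continuousOn_id.sub continuousOn_const).mul (continuousOn_const.sub hf₂.continuousOn_cdf))

lemma hasDerivAt_uniformRevenue (hf : IsPrior β f)
    (hf₁ : IsRegularDensity β (agentLaw f) f₁) (hf₂ : IsRegularDensity β (principalLaw f) f₂)
    {x : ℝ} (hx : x ∈ Ioo 0 β) :
    HasDerivAt (uniformRevenue b f)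
      (b * (f₂ x - f₁ x) - (x * f₂ x + principalCDF f x - 1)) x := by
  have := hf.isProbabilityMeasure_agentLaw
  have := hf.isProbabilityMeasure_principalLaw
  have h := (((hf₁.hasDerivAt_cdf hx).const_sub 1).const_mul b).add
    (((hasDerivAt_id x).sub_const b).mul ((hf₂.hasDerivAt_cdf hx).const_sub 1))
  refine h.congr_deriv ?_
  simp only [id, principalCDF]
  ring

/-- The difference of the marginal cdfs increases where the likelihood ratio is at most one. -/
lemma monotoneOn_principalCDF_sub_agentCDF (hf : IsPrior β f)
    (hf₁ : IsRegularDensity β (agentLaw f) f₁) (hf₂ : IsRegularDensity β (principalLaw f) f₂)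
    {c : ℝ} (hcβ : c ≤ β) (h : ∀ x ∈ Ioo 0 c, f₁ x ≤ f₂ x) :
    MonotoneOn (fun x => principalCDF f x - agentCDF f x) (Icc 0 c) := by
  have := hf.isProbabilityMeasure_agentLaw
  have := hf.isProbabilityMeasure_principalLaw
  have hd : ∀ x ∈ Ioo 0 c, HasDerivAt (fun x => principalCDF f x - agentCDF f x)
      (f₂ x - f₁ x) x := fun x hx =>
    (hf₂.hasDerivAt_cdf ⟨hx.1, hx.2.trans_le hcβ⟩).sub
      (hf₁.hasDerivAt_cdf ⟨hx.1, hx.2.trans_le hcβ⟩)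
  refine monotoneOn_of_deriv_nonneg (convex_Icc 0 c)
    ((hf₂.continuousOn_cdf.sub hf₁.continuousOn_cdf).mono (Icc_subset_Icc le_rfl hcβ)) ?_ ?_
  · rw [interior_Icc]
    exact fun x hx => (hd x hx).differentiableAt.differentiableWithinAt
  · rw [interior_Icc]
    intro x hx
    rw [(hd x hx).deriv]
    linarith [h x hx]

/-- A POST-2 mechanism with agent price above the crossing point earns at most a uniform one. -/
lemma post2_revenue_le_uniformRevenue (hf : IsPrior β f)
    (hf₂ : IsRegularDensity β (principalLaw f) f₂)
    {c : ℝ} (hc : CrossesAt β (principalCDF f) f₂ c) {α y k : ℝ} (hα : α ≤ 1)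
    (hyk : y ≤ k) (hkβ : k ≤ β) (hαy : α * y = b) (hcy : c ≤ y) :
    b * (1 - agentCDF f y) + (1 - α) * (max k c * (1 - principalCDF f (max k c))) ≤
      uniformRevenue b f y := by
  have := hf.isProbabilityMeasure_principalLaw
  have h : max k c * (1 - principalCDF f (max k c)) ≤ y * (1 - principalCDF f y) :=
    (hc.strictAntiOn hf₂).antitoneOn ⟨hcy, hyk.trans hkβ⟩
      ⟨le_max_right _ _, max_le hkβ hc.mem.2.le⟩ (hyk.trans (le_max_left _ _))
  have h2 := mul_le_mul_of_nonneg_left h (sub_nonneg.2 hα)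
  unfold uniformRevenue
  have : (1 - α) * (y * (1 - principalCDF f y)) = (y - b) * (1 - principalCDF f y) := by
    rw [← hαy]; ring
  linarith

/-- A POST-2 mechanism with agent price below the crossing point earns at most a uniform one. -/
lemma post2_revenue_le_uniformRevenue_of_lt (hf : IsPrior β f)
    (hf₁ : IsRegularDensity β (agentLaw f) f₁) (hf₂ : IsRegularDensity β (principalLaw f) f₂)
    (hconc : ConcaveOn ℝ (Icc 0 β) (fun x => x * (1 - agentCDF f x)))
    {c : ℝ} (hc : CrossesAt β (principalCDF f) f₂ c) (h : ∀ x ∈ Ioo 0 c, f₁ x ≤ f₂ x)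
    {α y k : ℝ} (hα0 : 0 ≤ α) (hα : α ≤ 1) (hy : 0 ≤ y) (hkβ : k ≤ β) (hαy : α * y = b)
    (hyc : y < c) :
    b * (1 - agentCDF f y) + (1 - α) * (max k c * (1 - principalCDF f (max k c))) ≤
      uniformRevenue b f (α * y + (1 - α) * c) := by
  have := hf.isProbabilityMeasure_principalLaw
  have hcI : c ∈ Icc 0 β := Ioo_subset_Icc_self hc.mem
  have h1 : max k c * (1 - principalCDF f (max k c)) ≤ c * (1 - principalCDF f c) :=
    (hc.strictAntiOn hf₂).antitoneOn ⟨le_rfl, hcI.2⟩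
      ⟨le_max_right _ _, max_le hkβ hcI.2⟩ (le_max_right _ _)
  have h2 := mul_le_mul_of_nonneg_left h1 (sub_nonneg.2 hα)
  have h3 := hconc.2 ⟨hy, hyc.le.trans hcI.2⟩ hcI hα0 (sub_nonneg.2 hα) (by ring)
  simp only [smul_eq_mul] at h3
  have hYc : α * y + (1 - α) * c ≤ c := by nlinarith
  have hY0 : 0 ≤ α * y + (1 - α) * c :=
    add_nonneg (mul_nonneg hα0 hy) (mul_nonneg (sub_nonneg.2 hα) hcI.1)
  have h4 := monotoneOn_principalCDF_sub_agentCDF hf hf₁ hf₂ hcI.2 h ⟨hY0, hYc⟩ ⟨hcI.1, le_rfl⟩ hYc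
  simp only at h4
  have h5 := mul_le_mul_of_nonneg_left h4 (mul_nonneg (sub_nonneg.2 hα) hcI.1)
  unfold uniformRevenue
  subst hαy
  set Y := α * y + (1 - α) * c with hY
  have e : (1 - α) * c = Y - α * y := by rw [hY]; ring
  have e2 : (1 - α) * (c * (1 - principalCDF f c)) = (1 - α) * (c * (1 - agentCDF f c)) -
    (1 - α) * c * (principalCDF f c - agentCDF f c) := by ring
  rw [e] at e2 h5
  linarith

/-- When the likelihood ratio exceeds one and the crossing point is passed, raising the price above
`b` loses revenue. -/
lemma antitoneOn_uniformRevenue (hb : 0 ≤ b) (hf : IsPrior β f)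
    (hf₁ : IsRegularDensity β (agentLaw f) f₁) (hf₂ : IsRegularDensity β (principalLaw f) f₂)
    {c : ℝ} (hc : CrossesAt β (principalCDF f) f₂ c) (hcb : c ≤ b)
    (h : ∀ x ∈ Ioo b β, f₂ x ≤ f₁ x) :
    AntitoneOn (uniformRevenue b f) (Icc b β) := by
  have hd : ∀ x ∈ Ioo b β, _ := fun x hx =>
    hasDerivAt_uniformRevenue (b := b) hf hf₁ hf₂ (x := x) ⟨hb.trans_lt hx.1, hx.2⟩
  refine antitoneOn_of_deriv_nonpos (convex_Icc b β)
    ((continuousOn_uniformRevenue hf hf₁ hf₂).mono (Icc_subset_Icc hb le_rfl)) ?_ ?_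
  · rw [interior_Icc]
    exact fun x hx => (hd x hx).differentiableAt.differentiableWithinAt
  · rw [interior_Icc]
    intro x hx
    rw [(hd x hx).deriv]
    have h1 := hc.pos x ⟨hcb.trans_lt hx.1, hx.2⟩
    have h2 := mul_nonpos_of_nonneg_of_nonpos hb (sub_nonpos.2 (h x hx))
    linarith

lemma optimal_price_of_likelihoodRatio_gt (hβ : 0 < β) (hb : 0 ≤ b) (hf : IsPrior β f)
    (hf₁ : IsRegularDensity β (agentLaw f) f₁) (hf₂ : IsRegularDensity β (principalLaw f) f₂)
    (hMLRP : MLRP β f₁ f₂)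
    (hconc : ConcaveOn ℝ (Icc 0 β) (fun x => x * (1 - agentCDF f x)))
    {c : ℝ} (hc : CrossesAt β (principalCDF f) f₂ c) {κ₁ : ℝ}
    (hκ₁ : IsMonopolyPrice β (agentCDF f) κ₁) (hbκ₁ : b < κ₁) (hcb : c ≤ b)
    (hr : 1 < f₁ b / f₂ b) :
    (uniformPost2 b b).IsOptimal β b f ∧ (post1 b).IsOptimal β b f := by
  have hbβ : b < β := hbκ₁.trans_le hκ₁.1.2
  have hb0 : 0 < b := hc.mem.1.trans_le hcb
  have hanti := antitoneOn_uniformRevenue hb hf hf₁ hf₂ hc hcb fun x hx => by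
    have hxI : x ∈ Ioo 0 β := ⟨hb.trans_lt hx.1, hx.2⟩
    have := hr.trans_le (hMLRP ⟨hb0, hbβ⟩ hxI hx.1.le)
    rw [lt_div_iff₀ (hf₂.pos x hxI)] at this
    linarith
  have hbound : ∀ M : Mechanism, M.IsFeasible β b f → M.revenue β f ≤ b * (1 - agentCDF f b) := by
    intro M hM
    obtain h | ⟨α, y, k, -, hα1, hy, hyk, hkβ, hαy, h⟩ :=
      revenue_le hβ hb hf hf₁ hf₂ hconc hc hκ₁ hbκ₁ hM
    · exact h
    · have hby : b ≤ y := by rw [← hαy]; exact mul_le_of_le_one_left hy hα1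
      have h1 := post2_revenue_le_uniformRevenue hf hf₂ hc hα1 hyk hkβ hαy (hcb.trans hby)
      have h2 := hanti ⟨le_rfl, hbβ.le⟩ ⟨hby, hyk.trans hkβ⟩ hby
      have h3 : uniformRevenue b f b = b * (1 - agentCDF f b) := by
        unfold uniformRevenue; ring
      linarith
  obtain ⟨p1, p2⟩ := uniformPost2_isFeasible_and_revenue hf hf₁ hf₂ hb hb0 le_rfl hbβ
  obtain ⟨q1, q2⟩ := post1_isFeasible_and_revenue hf hf₁ hf₂ hb hbβ
  refine ⟨⟨p1, fun M hM => ?_⟩, ⟨q1, fun M hM => ?_⟩⟩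
  · rw [p2, sub_self, zero_mul, add_zero]; exact hbound M hM
  · rw [q2]; exact hbound M hM

lemma exists_optimal_price (hβ : 0 < β) (hb : 0 ≤ b) (hf : IsPrior β f)
    (hf₁ : IsRegularDensity β (agentLaw f) f₁) (hf₂ : IsRegularDensity β (principalLaw f) f₂)
    (hMLRP : MLRP β f₁ f₂)
    (hconc : ConcaveOn ℝ (Icc 0 β) (fun x => x * (1 - agentCDF f x)))
    {c : ℝ} (hc : CrossesAt β (principalCDF f) f₂ c) {κ₁ : ℝ}
    (hκ₁ : IsMonopolyPrice β (agentCDF f) κ₁) (hbκ₁ : b < κ₁) (hbc : b < c)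
    (hr : f₁ c / f₂ c ≤ 1) :
    ∃ κ : ℝ, b < κ ∧ κ < β ∧
      κ * f₂ κ - (1 - principalCDF f κ) = b * (f₂ κ - f₁ κ) ∧
      (uniformPost2 b κ).IsOptimal β b f := by
  have := hf.isProbabilityMeasure_agentLaw
  have := hf.isProbabilityMeasure_principalLaw
  have hcβ : c < β := hc.mem.2
  have hle : ∀ x ∈ Ioo 0 c, f₁ x ≤ f₂ x := fun x hx => by
    have hxI : x ∈ Ioo 0 β := ⟨hx.1, hx.2.trans hcβ⟩
    have := (hMLRP hxI hc.mem hx.2.le).trans hr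
    rwa [div_le_one (hf₂.pos x hxI)] at this
  have hcont := continuousOn_uniformRevenue (b := b) hf hf₁ hf₂
  obtain ⟨κ, hκ, hmax⟩ := isCompact_Icc.exists_isMaxOn (nonempty_Icc.2 (hbc.trans hcβ).le)
    (hcont.mono (Icc_subset_Icc hb le_rfl))
  have hbc' : uniformRevenue b f b < uniformRevenue b f c := by
    refine strictMonoOn_of_deriv_pos (convex_Icc b c)
      (hcont.mono (Icc_subset_Icc hb hcβ.le)) (fun x hx => ?_) ⟨le_rfl, hbc.le⟩ ⟨hbc.le, le_rfl⟩ hbc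
    rw [interior_Icc] at hx
    have hx0 : x ∈ Ioo 0 c := ⟨hb.trans_lt hx.1, hx.2⟩
    rw [(hasDerivAt_uniformRevenue hf hf₁ hf₂ ⟨hx0.1, hx0.2.trans hcβ⟩).deriv]
    have h1 := hc.neg x hx0
    have h2 := mul_nonneg hb (sub_nonneg.2 (hle x hx0))
    linarith
  have hcκ : uniformRevenue b f c ≤ uniformRevenue b f κ := hmax ⟨hbc.le, hcβ.le⟩
  have hb0 : 0 ≤ uniformRevenue b f b := by
    unfold uniformRevenue
    rw [sub_self, zero_mul, add_zero]
    exact mul_nonneg hb (sub_nonneg.2 (ProbabilityTheory.cdf_le_one _ _))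
  have hβ0 : uniformRevenue b f β = 0 := by
    unfold uniformRevenue agentCDF principalCDF
    rw [hf₁.cdf_right hβ.le, hf₂.cdf_right hβ.le]; ring
  have hbκ : b < κ := by
    refine lt_of_le_of_ne hκ.1 ?_
    rintro rfl
    linarith
  have hκβ : κ < β := by
    refine lt_of_le_of_ne hκ.2 ?_
    rintro rfl
    linarith
  have hκ0 : 0 < κ := hb.trans_lt hbκ
  refine ⟨κ, hbκ, hκβ, ?_, ?_⟩
  · have := (hmax.isLocalMax (Icc_mem_nhds hbκ hκβ)).hasDerivAt_eq_zero
      (hasDerivAt_uniformRevenue hf hf₁ hf₂ ⟨hκ0, hκβ⟩)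
    linarith
  obtain ⟨p1, p2⟩ := uniformPost2_isFeasible_and_revenue hf hf₁ hf₂ hb hκ0 hbκ.le hκβ
  refine ⟨p1, fun M hM => ?_⟩
  rw [p2]
  change _ ≤ uniformRevenue b f κ
  obtain h | ⟨α, y, k, hα0, hα1, hy, hyk, hkβ, hαy, h⟩ :=
    revenue_le hβ hb hf hf₁ hf₂ hconc hc hκ₁ hbκ₁ hM
  · have : uniformRevenue b f b = b * (1 - agentCDF f b) := by unfold uniformRevenue; ring
    linarith
  refine h.trans ?_
  rcases le_or_gt c y with hcy | hyc
  · exact (post2_revenue_le_uniformRevenue hf hf₂ hc hα1 hyk hkβ hαy hcy).trans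
      (hmax ⟨hbc.le.trans hcy, hyk.trans hkβ⟩)
  · refine (post2_revenue_le_uniformRevenue_of_lt hf hf₁ hf₂ hconc hc hle hα0 hα1 hy hkβ hαy
      hyc).trans (hmax ⟨?_, ?_⟩)
    · rw [hαy]
      exact le_add_of_nonneg_right (mul_nonneg (sub_nonneg.2 hα1) hc.mem.1.le)
    · nlinarith

end price

end PrincipalAgent

end

theorem mainTheorem5 (β b : ℝ) (hβ : 0 < β) (hb : 0 ≤ b)
    (f : ℝ × ℝ → ℝ) (hf : PrincipalAgent.IsPrior β f)
    (f₁ f₂ : ℝ → ℝ)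
    (hf₁ : PrincipalAgent.IsRegularDensity β (PrincipalAgent.agentLaw f) f₁)
    (hf₂ : PrincipalAgent.IsRegularDensity β (PrincipalAgent.principalLaw f) f₂)
    (hMLRP : PrincipalAgent.MLRP β f₁ f₂)
    (hconc : StrictConcaveOn ℝ (Icc 0 β) (fun x => x * (1 - PrincipalAgent.agentCDF f x)))
    (hSC : PrincipalAgent.SingleCrossing β (PrincipalAgent.principalCDF f) f₂)
    (κ₁ κ₂ : ℝ)
    (hκ₁ : PrincipalAgent.IsMonopolyPrice β (PrincipalAgent.agentCDF f) κ₁)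
    (hκ₂ : PrincipalAgent.IsMonopolyPrice β (PrincipalAgent.principalCDF f) κ₂)
    (hbκ₁ : b < κ₁) :
    (b < κ₂ → f₁ κ₂ / f₂ κ₂ ≤ 1 →
      ∃ κ : ℝ, b < κ ∧ κ < β ∧
        κ * f₂ κ - (1 - PrincipalAgent.principalCDF f κ) = b * (f₂ κ - f₁ κ) ∧
        (PrincipalAgent.uniformPost2 b κ).IsOptimal β b f) ∧
    (κ₂ ≤ b → 1 < f₁ κ₂ / f₂ κ₂ →
      (PrincipalAgent.uniformPost2 b b).IsOptimal β b f ∧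
        (PrincipalAgent.post1 b).IsOptimal β b f) ∧
    (κ₂ ≤ b → f₁ κ₂ / f₂ κ₂ ≤ 1 → 1 < f₁ b / f₂ b →
      (PrincipalAgent.uniformPost2 b b).IsOptimal β b f ∧
        (PrincipalAgent.post1 b).IsOptimal β b f) := by
  have := hf.isProbabilityMeasure_principalLaw
  obtain ⟨c, hc⟩ := hSC.exists_crossesAt hf₂.pos
  obtain rfl : κ₂ = c := hc.eq_of_isMonopolyPrice hf₂ hκ₂
  have hbβ : b < β := hbκ₁.trans_le hκ₁.1.2
  refine ⟨fun h1 h2 => ?_, fun h1 h2 => ?_, fun h1 _ h3 => ?_⟩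
  · exact PrincipalAgent.exists_optimal_price hβ hb hf hf₁ hf₂ hMLRP hconc.concaveOn hc hκ₁ hbκ₁
      h1 h2
  · exact PrincipalAgent.optimal_price_of_likelihoodRatio_gt hβ hb hf hf₁ hf₂ hMLRP
      hconc.concaveOn hc hκ₁ hbκ₁ h1
      (h2.trans_le (hMLRP hc.mem ⟨hc.mem.1.trans_le h1, hbβ⟩ h1))
  · exact PrincipalAgent.optimal_price_of_likelihoodRatio_gt hβ hb hf hf₁ hf₂ hMLRP
      hconc.concaveOn hc hκ₁ hbκ₁ h1 h3
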